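/- Let $\mathbb F_q$ be a finite field with $q$ elements, let $\mathfrak n$ be a finite-dimensional nilpotent associative (non-unital) $\mathbb F_q$-algebra, and let $G=1+\mathfrak n$ be its algebra group: the set of formal sums $1+X$ ($X\in\mathfrak n$) with $(1+X)(1+Y)=1+X+Y+XY$. Fix a nontrivial homomorphism $\theta:\mathbb F_q^+\to\mathbb C^\times$ and $\lambda\in\mathfrak n^*=\mathrm{Hom}_{\mathbb F_q}(\mathfrak n,\mathbb F_q)$, and put $\theta_\lambda(1+X)=\theta(\lambda(X))$. For $g\in G$ let $(g\lambda)(X)=\lambda(g^{-1}X)$ and $(\lambda g)(X)=\lambda(Xg^{-1})$, with orbits $G\lambda$ and $\lambda G$. Define the subalgebras \[\mathfrak l_\lambda=\{X\in\mathfrak n:\lambda(XY)=0\ \forall\, Y\in\mathfrak n\},\quad \mathfrak s_\lambda=\{X\in\mathfrak n:\lambda(XY)=0\ \forall\, Y\in\mathfrak l_\lambda\},\quad \mathfrak k_\lambda=\mathfrak l_\lambda\cap\ker\lambda,\] and the subgroups $L_\lambda=1+\mathfrak l_\lambda$, $S_\lambda=1+\mathfrak s_\lambda$, $K_\lambda=1+\mathfrak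 k_\lambda$ of $G$; then $K_\lambda\subset L_\lambda\subset S_\lambda$, and $K_\lambda$ and $L_\lambda$ are normal in $S_\lambda$. Let $\pi:S_\lambda\to S_\lambda/K_\lambda$ be the quotient map, and let $\chi_\lambda=\mathrm{Ind}_{L_\lambda}^G(\theta_\lambda)$ be the supercharacter of $G$ indexed by $\lambda$. The group $S_\lambda$ acts on $\mathfrak s_\lambda^*$ by the coadjoint action $\kappa^g(X)=\kappa(gXg^{-1})$. All characters are complex. Then: (1) The number of irreducible constituents of $\chi_\lambda$ is the number of coadjoint $S_\lambda$-orbits in the set $\{\nu|_{\mathfrak s_\lambda}:\nu\in\lambda G\}\subset\mathfrak s_\lambda^*$. (2) For every integer $e\ge 0$, the number of irreducible constituents of $\chi_\lambda$ of degree $q^e$ is equal to the number of irreducible characters $\psi$ of $S_\lambda/K_\lambda$ such that \[\psi(\pi(z))=\frac{|G\lambda\cap\lambda G|}{|G\lambda|}\cdot q^e\cdot\theta_\lambda(z)\qquad\text{for all } z\in L_\lambda;\] in fact $\psi\mapsto\mathrm{Ind}_{S_\lambda}^G(\psi\circ\pi)$ is a bijection from the set of these $\psi$ onto the set of irreducible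 constituents of $\chi_\lambda$ of degree $q^e$. (3) If $(\mathfrak s_\lambda)^2\subset\ker\lambda$, where $(\mathfrak s_\lambda)^2$ is the span of the products $XY$ with $X,Y\in\mathfrak s_\lambda$, then for every integer $e\ge 0$ the number of irreducible constituents of $\chi_\lambda$ of degree $q^e$ is equal to the number of irreducible characters of $S_\lambda/L_\lambda$ of degree $\frac{|G\lambda\cap\lambda G|}{|G\lambda|}\,q^e$. -/

import Mathlib

noncomputable section

namespace AlgebraGroups

/-- The non-unital ring `N` is nilpotent: for some `k`, every product of `k + 1` elements of `N`
vanishes. -/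
class IsNilpotentRing (N : Type*) [NonUnitalRing N] : Prop where
  exists_prod_eq_zero : ∃ k : ℕ, ∀ (x : N) (l : List N), l.length = k →
    l.foldl (fun a b => a * b) x = 0

/-- The algebra group `1 + N`: the element `⟨X⟩` stands for the formal sum `1 + X`. -/
@[ext]
structure AlgGroup (N : Type*) where
  /-- The element `X = g - 1` of `N` for `g = 1 + X`. -/
  val : N

section Group

variable {N : Type*} [NonUnitalRing N]

instance : Mul (AlgGroup N) := ⟨fun g h => ⟨g.val + h.val + g.val * h.val⟩⟩

instance : One (AlgGroup N) := ⟨⟨0⟩⟩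

theorem AlgGroup.mul_val (g h : AlgGroup N) :
    (g * h).val = g.val + h.val + g.val * h.val := rfl

theorem AlgGroup.one_val : (1 : AlgGroup N).val = 0 := rfl

theorem exists_right_inv [IsNilpotentRing N] (x : N) : ∃ y : N, x + y + x * y = 0 := by
  obtain ⟨k, hk⟩ := IsNilpotentRing.exists_prod_eq_zero (N := N)
  have key : ∀ (l : ℕ) (a : N), ∃ y : N,
      a + y + x * y = (List.replicate l x).foldl (fun a b => a * b) a ∨
      a + y + x * y = -(List.replicate l x).foldl (fun a b => a * b) a ∨ a * x ≠ x * a := by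
    intro l
    induction l with
    | zero => intro a; exact ⟨0, Or.inl (by simp)⟩
    | succ n ih =>
      intro a
      by_cases hc : a * x = x * a
      · obtain ⟨y, h | h | h⟩ := ih (a * x)
        · refine ⟨-a - y, Or.inr (Or.inl ?_)⟩
          simp only [List.replicate_succ, List.foldl_cons]
          rw [← h, hc]
          noncomm_ring
        · refine ⟨-a - y, Or.inl ?_⟩
          simp only [List.replicate_succ, List.foldl_cons]
          rw [← neg_eq_iff_eq_neg.mpr h, hc]
          noncomm_ring
        · exact absurd (by rw [hc, mul_assoc, hc]) h
      · exact ⟨0, Or.inr (Or.inr hc)⟩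
  obtain ⟨y, h | h | h⟩ := key k x
  · exact ⟨y, by rw [h, hk x _ (by simp)]⟩
  · exact ⟨y, by rw [h, hk x _ (by simp), neg_zero]⟩
  · exact absurd rfl h

variable [IsNilpotentRing N]

instance : Inv (AlgGroup N) := ⟨fun g => ⟨Classical.choose (exists_right_inv g.val)⟩⟩

instance : Group (AlgGroup N) :=
  Group.ofRightAxioms
    (fun a b c => by
      ext
      simp only [AlgGroup.mul_val]
      noncomm_ring)
    (fun a => by
      ext
      simp [AlgGroup.mul_val, AlgGroup.one_val])
    (fun a => by
      ext
      exact Classical.choose_spec (exists_right_inv a.val))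

/-- The inverse `1 + B` of `1 + A`. -/
theorem AlgGroup.val_add_inv_val (g : AlgGroup N) :
    g.val + g⁻¹.val + g.val * g⁻¹.val = 0 := by
  rw [← AlgGroup.mul_val, mul_inv_cancel, AlgGroup.one_val]

end Group

section Algebra

variable {F : Type*} [Field F] {N : Type*} [NonUnitalRing N] [Module F N]
  [IsScalarTower F N N] [SMulCommClass F N N]

/-- Left multiplication `X ↦ g X` on `N`, where `(1 + A) X = X + A X`. -/
def lmul (g : AlgGroup N) : N →ₗ[F] N where
  toFun X := X + g.val * X
  map_add' X Y := by rw [mul_add]; abel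
  map_smul' c X := by simp [mul_smul_comm, smul_add]

/-- Right multiplication `X ↦ X g` on `N`, where `X (1 + A) = X + X A`. -/
def rmul (g : AlgGroup N) : N →ₗ[F] N where
  toFun X := X + X * g.val
  map_add' X Y := by rw [add_mul]; abel
  map_smul' c X := by simp [smul_mul_assoc, smul_add]

variable [IsNilpotentRing N]

/-- Conjugation `X ↦ g X g⁻¹` on `N`. -/
def Ad (g : AlgGroup N) : N →ₗ[F] N := (lmul g).comp (rmul g⁻¹)

/-- The left orbit `G λ`, where `(g λ)(X) = λ (g⁻¹ X)`. -/
def leftOrbit (lam : Module.Dual F N) : Set (Module.Dual F N) :=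
  Set.range fun g : AlgGroup N => lam.comp (lmul g⁻¹)

/-- The right orbit `λ G`, where `(λ g)(X) = λ (X g⁻¹)`. -/
def rightOrbit (lam : Module.Dual F N) : Set (Module.Dual F N) :=
  Set.range fun g : AlgGroup N => lam.comp (rmul g⁻¹)

theorem inv_val_mem (h : NonUnitalSubalgebra F N) {g : AlgGroup N} (hg : g.val ∈ h) :
    g⁻¹.val ∈ h := by
  obtain ⟨k, hk⟩ := IsNilpotentRing.exists_prod_eq_zero (N := N)
  have : IsNilpotentRing h := ⟨⟨k, fun x l hl => by
    apply Subtype.ext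
    have aux : ∀ (l : List h) (x : h), ((l.foldl (fun a b => a * b) x : h) : N) =
        (l.map Subtype.val).foldl (fun a b => a * b) (x : N) := by
      intro l
      induction l with
      | nil => intro x; rfl
      | cons a t ih => intro x; simp [ih]
    rw [aux, hk _ _ (by simpa using hl)]
    rfl⟩⟩
  obtain ⟨y, hy⟩ := exists_right_inv (⟨g.val, hg⟩ : h)
  have : g * ⟨(y : N)⟩ = 1 := by
    ext
    exact congrArg Subtype.val hy
  rw [inv_eq_of_mul_eq_one_right this]
  exact y.2

/-- The algebra subgroup `1 + h` attached to a subalgebra `h`. -/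
def algSubgroup (h : NonUnitalSubalgebra F N) : Subgroup (AlgGroup N) where
  carrier := {g | g.val ∈ h}
  mul_mem' {a b} ha hb := by
    have ha' : a.val ∈ h := ha
    have hb' : b.val ∈ h := hb
    exact add_mem (add_mem ha' hb') (mul_mem ha' hb')
  one_mem' := zero_mem h
  inv_mem' hg := inv_val_mem h hg

theorem mem_algSubgroup {h : NonUnitalSubalgebra F N} {g : AlgGroup N} :
    g ∈ algSubgroup h ↔ g.val ∈ h := Iff.rfl

theorem Ad_mem (h : NonUnitalSubalgebra F N) (g : algSubgroup h) {X : N}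
    (hX : X ∈ h.toSubmodule) : Ad (F := F) (g : AlgGroup N) X ∈ h.toSubmodule := by
  have hA : (g : AlgGroup N).val ∈ h := mem_algSubgroup.1 g.2
  have hB := inv_val_mem h hA
  have hX' : X ∈ h := hX
  have hY : X + X * (g : AlgGroup N)⁻¹.val ∈ h := add_mem hX' (mul_mem hX' hB)
  have hZ : X + X * (g : AlgGroup N)⁻¹.val +
      (g : AlgGroup N).val * (X + X * (g : AlgGroup N)⁻¹.val) ∈ h := add_mem hY (mul_mem hA hY)
  exact hZ

/-- The coadjoint orbit of `kappa ∈ h*` under the group `1 + h`: all the functionals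
`X ↦ kappa (g X g⁻¹)` with `g ∈ 1 + h`. -/
def coadjointOrbit (h : NonUnitalSubalgebra F N) (kappa : Module.Dual F h.toSubmodule) :
    Set (Module.Dual F h.toSubmodule) :=
  Set.range fun g : algSubgroup h =>
    kappa.comp ((Ad (g : AlgGroup N)).restrict fun _ hX => Ad_mem h g hX)

end Algebra

section Subalgebras

variable {F : Type*} [Field F] {N : Type*} [NonUnitalRing N] [Module F N]
  [IsScalarTower F N N] (lam : Module.Dual F N)

/-- `𝔩_λ = {X : λ (X Y) = 0 for all Y}`. -/
def lAlg : NonUnitalSubalgebra F N where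
  carrier := {X | ∀ Y, lam (X * Y) = 0}
  add_mem' ha hb Y := by rw [add_mul, map_add, ha, hb, add_zero]
  zero_mem' Y := by simp
  mul_mem' {a b} ha hb Y := by rw [mul_assoc]; exact ha _
  smul_mem' c X hX Y := by rw [smul_mul_assoc, map_smul, hX, smul_zero]

theorem mul_mem_lAlg {X Y : N} (hX : ∀ Z ∈ lAlg lam, lam (X * Z) = 0) (hY : Y ∈ lAlg lam) :
    X * Y ∈ lAlg lam := by
  intro Z
  rw [mul_assoc]
  exact hX _ fun W => by rw [mul_assoc]; exact hY _

/-- `𝔰_λ = {X : λ (X Y) = 0 for all Y ∈ 𝔩_λ}`. -/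
def sAlg : NonUnitalSubalgebra F N where
  carrier := {X | ∀ Y ∈ lAlg lam, lam (X * Y) = 0}
  add_mem' ha hb Y hY := by rw [add_mul, map_add, ha Y hY, hb Y hY, add_zero]
  zero_mem' Y _ := by simp
  mul_mem' {a b} ha hb Y hY := by rw [mul_assoc]; exact ha _ (mul_mem_lAlg lam hb hY)
  smul_mem' c X hX Y hY := by rw [smul_mul_assoc, map_smul, hX Y hY, smul_zero]

/-- `𝔨_λ = 𝔩_λ ∩ ker λ`. -/
def kAlg : NonUnitalSubalgebra F N where
  carrier := {X | X ∈ lAlg lam ∧ lam X = 0}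
  add_mem' ha hb := ⟨add_mem ha.1 hb.1, by rw [map_add, ha.2, hb.2, add_zero]⟩
  zero_mem' := ⟨zero_mem _, map_zero _⟩
  mul_mem' {a b} ha hb := ⟨mul_mem ha.1 hb.1, ha.1 b⟩
  smul_mem' c X hX := ⟨(lAlg lam).smul_mem' c hX.1, by rw [map_smul, hX.2, smul_zero]⟩

variable [SMulCommClass F N N] [IsNilpotentRing N]

/-- `L_λ = 1 + 𝔩_λ`, as a subgroup of `G = 1 + N`. -/
abbrev LGroup : Subgroup (AlgGroup N) := algSubgroup (lAlg lam)

/-- `S_λ = 1 + 𝔰_λ`, as a subgroup of `G = 1 + N`. -/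
abbrev SGroup : Subgroup (AlgGroup N) := algSubgroup (sAlg lam)

/-- `K_λ = 1 + 𝔨_λ`, as a subgroup of `G = 1 + N`. -/
abbrev KGroup : Subgroup (AlgGroup N) := algSubgroup (kAlg lam)

theorem AlgGroup.conj_val (g x : AlgGroup N) : (g * x * g⁻¹).val =
    x.val + g.val * x.val + x.val * g⁻¹.val + g.val * (x.val * g⁻¹.val) := by
  have h := AlgGroup.val_add_inv_val g
  simp only [AlgGroup.mul_val]
  calc _ = (g.val + g⁻¹.val + g.val * g⁻¹.val) + (x.val + g.val * x.val + x.val * g⁻¹.val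
          + g.val * (x.val * g⁻¹.val)) := by noncomm_ring
    _ = _ := by rw [h, zero_add]

theorem conj_mem_lAlg {g x : AlgGroup N} (hg : g ∈ SGroup lam) (hx : x.val ∈ lAlg lam) :
    (g * x * g⁻¹).val ∈ lAlg lam ∧ lam (g * x * g⁻¹).val = lam x.val := by
  have hxB : x.val * g⁻¹.val ∈ lAlg lam := fun W => by rw [mul_assoc]; exact hx _
  have hg' : ∀ Y ∈ lAlg lam, lam (g.val * Y) = 0 := mem_algSubgroup.1 hg
  rw [AlgGroup.conj_val]
  refine ⟨add_mem (add_mem (add_mem hx (mul_mem_lAlg lam hg' hx)) hxB)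
    (mul_mem_lAlg lam hg' hxB), ?_⟩
  rw [map_add, map_add, map_add, hg' _ hx, hx, hg' _ hxB]
  simp only [add_zero]

instance LGroup_normal : ((LGroup lam).subgroupOf (SGroup lam)).Normal :=
  ⟨fun x hx g => by
    have hx' : (x : AlgGroup N).val ∈ lAlg lam := hx
    exact (conj_mem_lAlg lam g.2 hx').1⟩

instance KGroup_normal : ((KGroup lam).subgroupOf (SGroup lam)).Normal :=
  ⟨fun x hx g => by
    have hx' : (x : AlgGroup N).val ∈ lAlg lam ∧ lam (x : AlgGroup N).val = 0 := hx
    have h := conj_mem_lAlg lam g.2 hx'.1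
    exact ⟨h.1, h.2.trans hx'.2⟩⟩

/-- The set `{ν|_{𝔰_λ} : ν ∈ λ G}`. -/
def restrictedOrbit : Set (Module.Dual F (sAlg lam).toSubmodule) :=
  (fun nu : Module.Dual F N => nu.comp (sAlg lam).toSubmodule.subtype) '' rightOrbit lam

end Subalgebras

section Characters

variable {G : Type*} [Group G]

/-- The irreducible complex characters of `G`, as functions. -/
def Irr (G : Type*) [Group G] : Set (G → ℂ) :=
  {chi | ∃ (V : Type) (_ : AddCommGroup V) (_ : Module ℂ V) (_ : FiniteDimensional ℂ V)
    (rho : Representation ℂ G V), rho.IsIrreducible ∧ rho.character = chi}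

/-- The inner product `⟨a, b⟩ = |G|⁻¹ ∑ₓ a(x) conj(b(x))` of functions on a finite group. -/
def cfInner (a b : G → ℂ) : ℂ :=
  (Nat.card G : ℂ)⁻¹ * ∑ᶠ x : G, a x * (starRingEnd ℂ) (b x)

open scoped ComplexOrder in
/-- The irreducible constituents of a character `chi`. -/
def constituents (chi : G → ℂ) : Set (G → ℂ) :=
  {psi | psi ∈ Irr G ∧ 0 < cfInner chi psi}

/-- The function on the finite group `G` induced from a function on a subgroup `H`:
`g ↦ |H|⁻¹ ∑ f(x g x⁻¹)`, over the `x ∈ G` with `x g x⁻¹ ∈ H`. -/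
def induced (H : Subgroup G) (f : H → ℂ) (g : G) : ℂ :=
  (Nat.card H : ℂ)⁻¹ * ∑ᶠ (x : G) (hx : x * g * x⁻¹ ∈ H), f ⟨x * g * x⁻¹, hx⟩

end Characters

section Supercharacters

variable {F : Type*} [Field F] {N : Type*} [NonUnitalRing N] [Module F N]

/-- `θ_λ (g) = θ (λ (g - 1))`. -/
def thetaFun (θ : AddChar F ℂ) (lam : Module.Dual F N) (g : AlgGroup N) : ℂ := θ (lam g.val)

variable [IsScalarTower F N N] [SMulCommClass F N N] [IsNilpotentRing N]

/-- The supercharacter `χ_λ`, induced from the function `θ_λ` on `L_λ` to `G`. -/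
def superchar (θ : AddChar F ℂ) (lam : Module.Dual F N) : AlgGroup N → ℂ :=
  induced (LGroup lam) fun z => thetaFun θ lam z

/-- The number `|G λ ∩ λ G| / |G λ|`. -/
def orbitRatio (lam : Module.Dual F N) : ℂ :=
  ((leftOrbit lam ∩ rightOrbit lam).ncard : ℂ) / ((leftOrbit lam).ncard : ℂ)

/-- The irreducible characters `ψ` of `S_λ / K_λ` with
`ψ (π z) = (|G λ ∩ λ G| / |G λ|) q ^ e θ_λ(z)` for all `z ∈ L_λ`. -/
def centralIrr (θ : AddChar F ℂ) (lam : Module.Dual F N) (e : ℕ) :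
    Set (SGroup lam ⧸ (KGroup lam).subgroupOf (SGroup lam) → ℂ) :=
  {psi | psi ∈ Irr (SGroup lam ⧸ (KGroup lam).subgroupOf (SGroup lam)) ∧
    ∀ z : SGroup lam, (z : AlgGroup N) ∈ LGroup lam →
      psi (QuotientGroup.mk z) = orbitRatio lam * (Nat.card F : ℂ) ^ e * thetaFun θ lam z}

end Supercharacters

end AlgebraGroups

end

noncomputable section

namespace AlgebraGroups

open Representation
open scoped ComplexConjugate Matrix ComplexOrder

/-! ### Character theory of finite groups: orthogonality and completeness -/

section CharacterTheory

variable {G : Type*} [Group G]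

/-! Write `L ≤ S ≤ G` for the groups attached to `λ`, and `θ_λ` for the linear character of `L`,
which is invariant under `S`. The argument has three ingredients.

Clifford-Mackey step. Inducing from `S` to `G` is a bijection from the irreducible characters of `S`
lying over `θ_λ` (`IrrOver`) onto the constituents of `χ_λ` (`bijOn_induced_constituents`). The
crucial point is that `S` is large enough: every `x ∉ S` admits `z ∈ L` with `x z x⁻¹ ∈ L` and
`θ_λ(x z x⁻¹) ≠ θ_λ(z)`, so the Mackey terms outside `S` vanish. This is linear algebra
(`mem_SGroup_of_forall`): the annihilator of an intersection is the sum of the annihilators, and the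
annihilator of `𝔩_λ` consists exactly of the functionals `X ↦ λ(XY)`.

Counting. The set `IrrOver` is a basis of the class functions `f` on `S` with `f(sz) = f(s) θ_λ(z)`
for `z ∈ L`. Under the additive Fourier transform on `𝔰_λ`, class functions correspond to functions
on `𝔰_λ*` constant on coadjoint orbits, and equivariance under `L` corresponds to support in `{κ : κ
= λ on 𝔩_λ}`, which is the restriction of `λG`. The dimension is therefore the number of orbits,
which is (1).

Degrees. Since `gλ ∈ λG` exactly when `g ∈ S`, the ratio `|Gλ ∩ λG| / |Gλ|` equals `|S| / |G|`, the
factor by which degrees drop in passing from `G` to `S`. As `θ_λ` is trivial on `K`, the characters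
over `θ_λ` are inflated from `S/K`, which gives (2). If `λ` kills `(𝔰_λ)²`, then `θ_λ` extends to a
linear character of `S`, and twisting by it identifies them with the irreducible characters of
`S/L`, which gives (3). -/

theorem cfInner_eq_sum {G : Type*} [Fintype G] (a b : G → ℂ) :
    cfInner a b = (Nat.card G : ℂ)⁻¹ * ∑ x : G, a x * conj (b x) := by
  rw [cfInner, finsum_eq_sum_of_fintype]

/-- Averaging yields a positive definite invariant Hermitian form `H`, so `M g⁻¹` is the conjugate
by `H` of the adjoint of `M g`. -/
theorem trace_inv_eq_conj [Finite G] {n : Type*} [Fintype n] [DecidableEq n]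
    (M : G →* Matrix n n ℂ) (g : G) : (M g⁻¹).trace = conj (M g).trace := by
  classical
  have := Fintype.ofFinite G
  set H : Matrix n n ℂ := ∑ h : G, (M h)ᴴ * M h with hH
  have hpos : H.PosDef := by
    rw [hH, ← Finset.add_sum_erase _ _ (Finset.mem_univ 1)]
    refine Matrix.PosDef.add_posSemidef (by simpa using Matrix.PosDef.one) ?_
    exact Matrix.posSemidef_sum _ fun h _ => Matrix.posSemidef_conjTranspose_mul_self _
  have hinv : (M g)ᴴ * H * M g = H := by
    rw [hH, Finset.mul_sum, Finset.sum_mul,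
      ← Equiv.sum_comp (Equiv.mulRight g) fun h => (M h)ᴴ * M h]
    refine Finset.sum_congr rfl fun h _ => ?_
    simp only [Equiv.coe_mulRight, map_mul, Matrix.conjTranspose_mul, mul_assoc]
  have hgg : M g * M g⁻¹ = 1 := by rw [← map_mul, mul_inv_cancel, map_one]
  have hdet : IsUnit H.det := (Matrix.isUnit_iff_isUnit_det _).1 hpos.isUnit
  have h1 : (M g)ᴴ * H = H * M g⁻¹ := by
    conv_rhs => rw [← hinv]
    rw [mul_assoc _ (M g), hgg, mul_one]
  have h2 : M g⁻¹ = H⁻¹ * ((M g)ᴴ * H) := by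
    rw [h1, ← mul_assoc, Matrix.nonsing_inv_mul _ hdet, one_mul]
  rw [h2, Matrix.trace_mul_comm, mul_assoc, Matrix.mul_nonsing_inv _ hdet, mul_one,
    Matrix.trace_conjTranspose]
  rfl

theorem character_inv [Finite G] {V : Type*} [AddCommGroup V] [Module ℂ V]
    [FiniteDimensional ℂ V] (rho : Representation ℂ G V) (g : G) :
    rho.character g⁻¹ = conj (rho.character g) := by
  let b := Module.finBasis ℂ V
  let M : G →* Matrix _ _ ℂ := (LinearMap.toMatrixAlgEquiv b).toMulEquiv.toMonoidHom.comp rho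
  have key : ∀ x, rho.character x = (M x).trace := fun x =>
    LinearMap.trace_eq_matrix_trace ℂ b (rho x)
  rw [key, key, trace_inv_eq_conj]

theorem cfInner_character [Finite G] {V W : Type*} [AddCommGroup V] [Module ℂ V]
    [FiniteDimensional ℂ V] [AddCommGroup W] [Module ℂ W] [FiniteDimensional ℂ W]
    (rho : Representation ℂ G V) (sigma : Representation ℂ G W) :
    cfInner rho.character sigma.character = Module.finrank ℂ (IntertwiningMap sigma rho) := by
  have := Fintype.ofFinite G
  have : Invertible (Nat.card G : ℂ) := invertibleOfNonzero (by simp)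
  rw [cfInner_eq_sum, ← card_inv_mul_sum_char_mul_char_eq_finrank]
  simp only [character_inv]

theorem cfInner_self_of_mem_Irr [Finite G] {chi : G → ℂ} (h : chi ∈ Irr G) :
    cfInner chi chi = 1 := by
  obtain ⟨V, _, _, _, rho, hrho, rfl⟩ := h
  rw [cfInner_character, IsIrreducible.finrank_intertwiningMap_self, Nat.cast_one]

theorem cfInner_eq_zero_of_ne [Finite G] {chi psi : G → ℂ} (h : chi ∈ Irr G) (h' : psi ∈ Irr G)
    (hne : chi ≠ psi) : cfInner chi psi = 0 := by
  obtain ⟨V, _, _, _, rho, hrho, rfl⟩ := h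
  obtain ⟨W, _, _, _, sigma, hsigma, rfl⟩ := h'
  have : IsEmpty (Representation.Equiv sigma rho) := ⟨fun f => hne (char_iso f).symm⟩
  rw [cfInner_character, Module.finrank_zero_of_subsingleton, Nat.cast_zero]

theorem isIrreducible_iff {V : Type*} [AddCommGroup V] [Module ℂ V]
    (rho : Representation ℂ G V) : rho.IsIrreducible ↔ Nontrivial V ∧
      ∀ W : Submodule ℂ V, (∀ g, ∀ v ∈ W, rho g v ∈ W) → W = ⊥ ∨ W = ⊤ := by
  constructor
  · intro h
    refine ⟨?_, fun W hW => ?_⟩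
    · by_contra hV
      rw [not_nontrivial_iff_subsingleton] at hV
      exact bot_ne_top (α := Subrepresentation rho)
        (Subrepresentation.toSubmodule_injective (Subsingleton.elim _ _))
    · exact (eq_bot_or_eq_top (⟨W, fun g v => hW g v⟩ : Subrepresentation rho)).imp
        (congrArg Subrepresentation.toSubmodule) (congrArg Subrepresentation.toSubmodule)
  · rintro ⟨hV, h⟩
    have : Nontrivial (Subrepresentation rho) := ⟨⊥, ⊤, fun h =>
      bot_ne_top (α := Submodule ℂ V) (congrArg Subrepresentation.toSubmodule h)⟩
    exact ⟨fun W => (h W.toSubmodule fun g v hv => W.apply_mem_toSubmodule g hv).imp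
      (fun h => Subrepresentation.toSubmodule_injective h)
      (fun h => Subrepresentation.toSubmodule_injective h)⟩

/-- `Irr` only admits spaces in `Type`; transport to `ℂⁿ` along a basis removes this universe
restriction. -/
theorem character_mem_Irr {V : Type*} [AddCommGroup V] [Module ℂ V] [FiniteDimensional ℂ V]
    (rho : Representation ℂ G V) (h : rho.IsIrreducible) : rho.character ∈ Irr G := by
  rw [isIrreducible_iff] at h
  obtain ⟨hV, h⟩ := h
  let e : V ≃ₗ[ℂ] (Fin (Module.finrank ℂ V) → ℂ) := (Module.finBasis ℂ V).equivFun
  let sigma : Representation ℂ G (Fin (Module.finrank ℂ V) → ℂ) :=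
    (e.conjRingEquiv : _ →* _).comp rho
  have hsigma : ∀ g v, sigma g v = e (rho g (e.symm v)) := fun g v => rfl
  refine ⟨_, _, _, inferInstance, sigma,
    (isIrreducible_iff _).2 ⟨e.symm.toEquiv.nontrivial, ?_⟩, ?_⟩
  · intro W hW
    rcases h (W.comap e.toLinearMap) (fun g v hv => by
      have := hW g (e v) hv
      rwa [hsigma, e.symm_apply_apply] at this) with h0 | h0
    · left
      rw [eq_bot_iff]
      intro w hw
      have : e.symm w ∈ W.comap e.toLinearMap := by simpa using hw
      rw [h0, Submodule.mem_bot] at this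
      simpa using this
    · right
      rw [eq_top_iff]
      intro w _
      have : e.symm w ∈ W.comap e.toLinearMap := by rw [h0]; trivial
      simpa using this
  · ext g
    exact LinearMap.trace_conj' (rho g) e

theorem Irr_one_pos {chi : G → ℂ} (h : chi ∈ Irr G) : ∃ n : ℕ, 0 < n ∧ chi 1 = n := by
  obtain ⟨V, _, _, _, rho, hrho, rfl⟩ := h
  have := ((isIrreducible_iff _).1 hrho).1
  exact ⟨_, Module.finrank_pos (R := ℂ) (M := V), char_one _⟩

theorem exists_eq_smul_of_commute {V : Type*} [AddCommGroup V] [Module ℂ V]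
    [FiniteDimensional ℂ V] {rho : Representation ℂ G V} (h : rho.IsIrreducible)
    (T : V →ₗ[ℂ] V) (hT : ∀ g v, T (rho g v) = rho g (T v)) : ∃ c : ℂ, T = c • 1 := by
  obtain ⟨c, hc⟩ := (IsIrreducible.algebraMap_intertwiningMap_bijective_of_isAlgClosed
    (ρ := rho)).2 (T.intertwiningMap_of_isIntertwiningMap rho rho hT)
  refine ⟨c, ?_⟩
  ext v
  exact (congrArg (fun f : IntertwiningMap rho rho => f v) hc).symm

/-- `f` is constant on conjugacy classes. -/
def IsClassFun (f : G → ℂ) : Prop := ∀ g h, f (h * g * h⁻¹) = f g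

theorem Irr_isClassFun {chi : G → ℂ} (h : chi ∈ Irr G) : IsClassFun chi := by
  obtain ⟨V, _, _, _, rho, hrho, rfl⟩ := h
  exact fun g h => char_conj _ g h

/-- The operator commutes with `rho` because `f` is a class function, so it is a scalar by Schur's
lemma. Its trace is `|G|` times the inner product of `f` with the character, hence zero. -/
theorem sum_smul_eq_zero_of_cfInner [Fintype G] {f : G → ℂ} (hf : IsClassFun f)
    {V : Type*} [AddCommGroup V] [Module ℂ V] [FiniteDimensional ℂ V]
    {rho : Representation ℂ G V} (h : rho.IsIrreducible)
    (h0 : cfInner f rho.character = 0) : ∑ g, f g • rho g⁻¹ = 0 := by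
  obtain ⟨c, hc⟩ := exists_eq_smul_of_commute h (∑ g, f g • rho g⁻¹) (fun x v => by
    simp only [LinearMap.sum_apply, LinearMap.smul_apply, map_sum, map_smul]
    rw [← Equiv.sum_comp (MulAut.conj x).toEquiv]
    refine Finset.sum_congr rfl fun g _ => ?_
    simp only [MulEquiv.toEquiv_eq_coe, EquivLike.coe_coe, MulAut.conj_apply, hf g x]
    rw [← Module.End.mul_apply, ← Module.End.mul_apply, ← map_mul, ← map_mul]
    congr 3
    group)
  have hV := ((isIrreducible_iff _).1 h).1
  have htr : LinearMap.trace ℂ V (∑ g, f g • rho g⁻¹) = 0 := by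
    rw [cfInner_eq_sum, mul_eq_zero] at h0
    have h1 := h0.resolve_left (by simp)
    simp only [← character_inv] at h1
    simpa [Representation.character] using h1
  rw [hc, map_smul, LinearMap.trace_one, smul_eq_mul, mul_eq_zero] at htr
  have hc0 : c = 0 := htr.resolve_right (by
    have := Module.finrank_pos (R := ℂ) (M := V)
    exact_mod_cast this.ne')
  rw [hc, hc0, zero_smul]

theorem ofModule'_isIrreducible {M : Type*} [AddCommGroup M] [Module ℂ M]
    [Module (MonoidAlgebra ℂ G) M] [IsScalarTower ℂ (MonoidAlgebra ℂ G) M]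
    [h : IsSimpleModule (MonoidAlgebra ℂ G) M] :
    (Representation.ofModule' (k := ℂ) (G := G) M).IsIrreducible := by
  rw [isIrreducible_iff]
  refine ⟨IsSimpleModule.nontrivial (MonoidAlgebra ℂ G) M, fun W hW => ?_⟩
  let W' : Submodule (MonoidAlgebra ℂ G) M :=
    { W with
      smul_mem' := fun a v hv => by
        induction a using MonoidAlgebra.induction_on with
        | of g => exact hW g v hv
        | add a b ha hb => rw [add_smul]; exact W.add_mem ha hb
        | smul r a ha => rw [smul_assoc]; exact W.smul_mem r ha }
  have hmem : ∀ v, v ∈ W' ↔ v ∈ W := fun v => Iff.rfl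
  rcases eq_bot_or_eq_top W' with h0 | h0
  · left; ext v; rw [← hmem, h0]; simp
  · right; ext v; rw [← hmem, h0]; simp

/-- The element `∑ f(g) g⁻¹` of the group algebra acts as zero on every simple quotient, so it lies
in every maximal left ideal. The Jacobson radical is zero by Maschke's theorem. -/
theorem IsClassFun.eq_zero_of_cfInner [Finite G] {f : G → ℂ} (hf : IsClassFun f)
    (h0 : ∀ chi ∈ Irr G, cfInner f chi = 0) : f = 0 := by
  classical
  have := Fintype.ofFinite G
  have hfinA : FiniteDimensional ℂ (MonoidAlgebra ℂ G) :=
    Module.Finite.equiv (MonoidAlgebra.coeffLinearEquiv ℂ).symm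
  let a : MonoidAlgebra ℂ G := ∑ g, MonoidAlgebra.single g⁻¹ (f g)
  have hNZ : NeZero (Nat.card G : ℂ) := ⟨by simp⟩
  have ha : a = 0 := by
    have hj := IsSemisimpleModule.jacobson_eq_bot (MonoidAlgebra ℂ G) (MonoidAlgebra ℂ G)
    suffices a ∈ Module.jacobson (MonoidAlgebra ℂ G) (MonoidAlgebra ℂ G) by
      rwa [hj, Submodule.mem_bot] at this
    rw [Module.jacobson, Submodule.mem_sInf]
    intro m hm
    have hs : IsSimpleModule (MonoidAlgebra ℂ G) (MonoidAlgebra ℂ G ⧸ m) :=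
      isSimpleModule_iff_isCoatom.2 hm
    have hfin : FiniteDimensional ℂ (MonoidAlgebra ℂ G ⧸ m) :=
      Module.Finite.of_surjective (m.mkQ.restrictScalars ℂ) (Submodule.mkQ_surjective m)
    have hirr := ofModule'_isIrreducible (G := G) (M := MonoidAlgebra ℂ G ⧸ m)
    have hz := sum_smul_eq_zero_of_cfInner hf hirr (h0 _ (character_mem_Irr _ hirr))
    have hz1 := LinearMap.congr_fun hz (Submodule.Quotient.mk 1)
    rw [LinearMap.zero_apply, LinearMap.sum_apply] at hz1
    rw [← Submodule.Quotient.mk_eq_zero, ← hz1, ← mul_one a, ← smul_eq_mul,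
      Submodule.Quotient.mk_smul, Finset.sum_smul]
    refine Finset.sum_congr rfl fun g _ => ?_
    have : (MonoidAlgebra.single g⁻¹ (f g) : MonoidAlgebra ℂ G) =
      f g • MonoidAlgebra.of ℂ G g⁻¹ := by simp
    rw [this, smul_assoc]
    rfl
  ext g
  have := congrArg (fun b : MonoidAlgebra ℂ G => b.coeff g⁻¹) ha
  simpa [a, MonoidAlgebra.coeff_sum, Finsupp.single_apply] using this

theorem cfInner_add_left {G : Type*} [Finite G] (a b c : G → ℂ) :
    cfInner (a + b) c = cfInner a c + cfInner b c := by
  have := Fintype.ofFinite G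
  simp [cfInner_eq_sum, add_mul, Finset.sum_add_distrib, mul_add]

theorem cfInner_smul_left {G : Type*} [Finite G] (r : ℂ) (a c : G → ℂ) :
    cfInner (r • a) c = r * cfInner a c := by
  have := Fintype.ofFinite G
  simp only [cfInner_eq_sum, Pi.smul_apply, smul_eq_mul, Finset.mul_sum]
  exact Finset.sum_congr rfl fun x _ => by ring

theorem cfInner_symm {G : Type*} [Finite G] (a b : G → ℂ) : cfInner b a = conj (cfInner a b) := by
  have := Fintype.ofFinite G
  simp [cfInner_eq_sum, mul_comm]

/-- The map `a ↦ ⟨a, b⟩` as a linear functional. -/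
def cfInnerLeft [Finite G] (b : G → ℂ) : (G → ℂ) →ₗ[ℂ] ℂ where
  toFun a := cfInner a b
  map_add' a c := cfInner_add_left a c b
  map_smul' r a := cfInner_smul_left r a b

theorem cfInner_sum_left {G : Type*} [Finite G] {ι : Type*} (s : Finset ι) (a : ι → G → ℂ)
    (b : G → ℂ) :
    cfInner (∑ i ∈ s, a i) b = ∑ i ∈ s, cfInner (a i) b :=
  map_sum (cfInnerLeft b) a s

theorem Irr_linearIndependent [Finite G] : LinearIndepOn ℂ id (Irr G) := by
  classical
  rw [linearIndepOn_iff']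
  intro s g hs h0 i hi
  have h1 := congrArg (fun a => cfInner a i) h0
  simp only [id, cfInner_sum_left, cfInner_smul_left] at h1
  rw [Finset.sum_eq_single i, cfInner_self_of_mem_Irr (hs hi)] at h1
  · rw [mul_one] at h1
    rw [h1]
    exact map_zero (cfInnerLeft i)
  · intro j hj hji
    rw [cfInner_eq_zero_of_ne (hs hj) (hs hi) hji, mul_zero]
  · exact fun h => absurd hi h

theorem Irr_finite [Finite G] : (Irr G).Finite :=
  LinearIndependent.setFinite Irr_linearIndependent

theorem IsClassFun.sub {f g : G → ℂ} (hf : IsClassFun f) (hg : IsClassFun g) :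
    IsClassFun (f - g) := fun x h => by simp [hf x h, hg x h]

theorem IsClassFun.eq_sum_Irr [Finite G] {f : G → ℂ} (hf : IsClassFun f) :
    f = ∑ chi ∈ (Irr_finite (G := G)).toFinset, cfInner f chi • chi := by
  classical
  rw [← sub_eq_zero]
  apply IsClassFun.eq_zero_of_cfInner
  · refine hf.sub fun x h => ?_
    simp only [Finset.sum_apply, Pi.smul_apply]
    refine Finset.sum_congr rfl fun chi hchi => ?_
    rw [Irr_isClassFun ((Set.Finite.mem_toFinset _).1 hchi)]
  · intro psi hpsi
    have : cfInner (f - ∑ chi ∈ (Irr_finite (G := G)).toFinset, cfInner f chi • chi) psi =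
        cfInner f psi -
          cfInner (∑ chi ∈ (Irr_finite (G := G)).toFinset, cfInner f chi • chi) psi :=
      map_sub (cfInnerLeft psi) _ _
    rw [this, cfInner_sum_left, Finset.sum_eq_single psi, cfInner_smul_left,
      cfInner_self_of_mem_Irr hpsi, mul_one, sub_self]
    · intro chi hchi hne
      rw [cfInner_smul_left,
        cfInner_eq_zero_of_ne ((Set.Finite.mem_toFinset _).1 hchi) hpsi hne, mul_zero]
    · exact fun h => absurd ((Set.Finite.mem_toFinset _).2 hpsi) h

/-- The coefficients of `f` in the basis `Irr G` are natural numbers whose squares sum to 1, so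
exactly one of them is 1 and the others vanish. -/
theorem IsClassFun.mem_Irr_of_cfInner_self [Finite G] {f : G → ℂ} (hf : IsClassFun f)
    (hn : ∀ chi ∈ Irr G, ∃ n : ℕ, cfInner f chi = n) (h1 : cfInner f f = 1) : f ∈ Irr G := by
  classical
  choose! n hn using hn
  set s := (Irr_finite (G := G)).toFinset with hs
  have hmem : ∀ chi ∈ s, chi ∈ Irr G := fun chi h => (Set.Finite.mem_toFinset _).1 h
  have hsum : ∑ chi ∈ s, n chi * n chi = 1 := by
    have : (∑ chi ∈ s, (n chi * n chi : ℂ)) = 1 := by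
      rw [← h1]
      conv_rhs => rw [hf.eq_sum_Irr]
      rw [cfInner_sum_left]
      refine Finset.sum_congr rfl fun chi hchi => ?_
      rw [← hf.eq_sum_Irr, cfInner_smul_left, cfInner_symm f, hn chi (hmem chi hchi)]
      simp
    exact_mod_cast this
  obtain ⟨chi, hchi, hne⟩ : ∃ chi ∈ s, n chi * n chi ≠ 0 := by
    by_contra! h
    rw [Finset.sum_eq_zero h] at hsum
    exact zero_ne_one hsum
  rw [← Finset.add_sum_erase _ _ hchi] at hsum
  have hchi1 : n chi * n chi = 1 := by omega
  have hrest : ∑ psi ∈ s.erase chi, n psi * n psi = 0 := by omega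
  rw [Finset.sum_eq_zero_iff] at hrest
  have : f = chi := by
    conv_lhs => rw [hf.eq_sum_Irr]
    rw [← hs, Finset.sum_eq_single chi, hn chi (hmem chi hchi),
      Nat.eq_one_of_mul_eq_one_right hchi1]
    · simp
    · intro psi hpsi hne'
      have := hrest psi (Finset.mem_erase.2 ⟨hne', hpsi⟩)
      rw [hn psi (hmem psi hpsi), mul_self_eq_zero.1 this]
      simp
    · exact fun h => absurd hchi h
  rw [this]
  exact hmem chi hchi

theorem exists_cfInner_restrict_eq_natCast [Finite G] (H : Subgroup G) {psi : H → ℂ} {chi : G → ℂ}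
    (hpsi : psi ∈ Irr H) (hchi : chi ∈ Irr G) : ∃ n : ℕ, cfInner psi (fun h => chi h) = n := by
  obtain ⟨V, _, _, _, rho, hrho, rfl⟩ := hpsi
  obtain ⟨W, _, _, _, sigma, hsigma, rfl⟩ := hchi
  exact ⟨_, cfInner_character rho (sigma.comp H.subtype)⟩

end CharacterTheory

end AlgebraGroups

end

noncomputable section

namespace AlgebraGroups

open Representation
open scoped ComplexConjugate ComplexOrder

/-! ### Characters lying over an invariant linear character of a normal subgroup -/

section Clifford

variable {S : Type*} [Group S]

/-- The function `t` restricts to a unitary linear character of `A` that is invariant under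
conjugation by `S`. -/
structure IsInvariantChar (A : Subgroup S) (t : S → ℂ) : Prop where
  conj_eq : ∀ s, ∀ z ∈ A, t (s * z * s⁻¹) = t z
  apply_mul : ∀ z ∈ A, ∀ w ∈ A, t (z * w) = t z * t w
  mul_conj : ∀ z ∈ A, t z * conj (t z) = 1

/-- The irreducible characters of `S` whose restriction to `A` is a multiple of `t`. -/
def IrrOver (A : Subgroup S) (t : S → ℂ) : Set (S → ℂ) :=
  {psi | psi ∈ Irr S ∧ ∀ z ∈ A, psi z = psi 1 * t z}

/-- The class functions on `S` on which translation by `z ∈ A` is multiplication by `t z`. -/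
def equivariantFun (A : Subgroup S) (t : S → ℂ) : Submodule ℂ (S → ℂ) where
  carrier := {f | IsClassFun f ∧ ∀ s, ∀ z ∈ A, f (s * z) = f s * t z}
  add_mem' ha hb := ⟨fun g h => by simp [ha.1 g h, hb.1 g h], fun s z hz => by
    simp [ha.2 s z hz, hb.2 s z hz, add_mul]⟩
  zero_mem' := ⟨fun _ _ => rfl, fun _ _ _ => by simp⟩
  smul_mem' c f hf := ⟨fun g h => by simp [hf.1 g h], fun s z hz => by
    simp [hf.2 s z hz, mul_assoc]⟩

variable {A : Subgroup S} {t : S → ℂ}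

/-- The sum is, up to the factor `|A|`, the projection onto the `t`-isotypic part. It commutes with
`S` by invariance of `t`, so Schur's lemma leaves only zero or a nonzero scalar. -/
theorem IsInvariantChar.scalar_or_sum_eq_zero [A.Normal] [Fintype A] (ht : IsInvariantChar A t)
    {V : Type*} [AddCommGroup V] [Module ℂ V] [FiniteDimensional ℂ V]
    {rho : Representation ℂ S V} (h : rho.IsIrreducible) :
    (∀ z ∈ A, rho z = t z • 1) ∨ ∑ z : A, conj (t z) • rho z = 0 := by
  set T := ∑ z : A, conj (t z) • rho z with hT
  obtain ⟨c, hc⟩ := exists_eq_smul_of_commute h T (fun s v => by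
    simp only [hT, LinearMap.sum_apply, LinearMap.smul_apply, map_sum, map_smul]
    rw [← Equiv.sum_comp (MulAut.conjNormal s).toEquiv]
    refine Finset.sum_congr rfl fun z _ => ?_
    simp only [MulEquiv.toEquiv_eq_coe, EquivLike.coe_coe, MulAut.conjNormal_apply,
      ht.conj_eq s z z.2]
    rw [← Module.End.mul_apply, ← Module.End.mul_apply, ← map_mul rho, ← map_mul rho,
      inv_mul_cancel_right])
  by_cases hc0 : c = 0
  · right
    rw [hc, hc0, zero_smul]
  · left
    intro w hw
    -- `T` absorbs `rho w` up to the factor `t w`; dividing by the scalar `c ≠ 0` then gives `rho w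
    -- = t w`.
    have h1 : rho w * T = t w • T := by
      rw [hT, Finset.mul_sum, Finset.smul_sum,
        ← Equiv.sum_comp (Equiv.mulLeft (⟨w, hw⟩ : A)) fun z : A => t w • conj (t z) • rho z]
      refine Finset.sum_congr rfl fun z _ => ?_
      rw [Equiv.coe_mulLeft, Subgroup.coe_mul, ht.apply_mul w hw z z.2, map_mul (starRingEnd ℂ),
        smul_smul, ← mul_assoc, ht.mul_conj w hw, one_mul, map_mul rho, mul_smul_comm]
    rw [hc, mul_smul_comm, mul_one, smul_comm] at h1
    exact smul_right_injective _ hc0 h1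

theorem IsInvariantChar.apply_one (ht : IsInvariantChar A t) : t 1 = 1 := by
  have h1 := ht.mul_conj 1 A.one_mem
  have h2 := ht.apply_mul 1 A.one_mem 1 A.one_mem
  rw [mul_one] at h2
  have h3 : t 1 ≠ 0 := fun h => by simp [h] at h1
  exact (mul_left_cancel₀ h3 (by rw [mul_one, ← h2])).symm

theorem IrrOver_finite [Finite S] : (IrrOver A t).Finite := Irr_finite.subset fun _ h => h.1

variable [Finite S] [A.Normal]

/-- The vanishing alternative is impossible here: the trace of the sum would be `|A|` times the
degree. -/
theorem IsInvariantChar.rho_eq_smul (ht : IsInvariantChar A t)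
    {V : Type*} [AddCommGroup V] [Module ℂ V] [FiniteDimensional ℂ V]
    {rho : Representation ℂ S V} (h : rho.IsIrreducible) (hpsi : rho.character ∈ IrrOver A t) :
    ∀ z ∈ A, rho z = t z • 1 := by
  have := Fintype.ofFinite A
  refine (ht.scalar_or_sum_eq_zero h).resolve_right fun h0 => ?_
  obtain ⟨n, hn, hn1⟩ := Irr_one_pos hpsi.1
  have h1 := congrArg (LinearMap.trace ℂ V) h0
  rw [map_zero, map_sum, Finset.sum_congr rfl (g := fun _ => (n : ℂ))] at h1
  · simp [hn.ne'] at h1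
  · intro z _
    have h2 : LinearMap.trace ℂ V (rho z) = n * t z := by
      rw [← hn1]; exact hpsi.2 z z.2
    rw [map_smul, h2, smul_eq_mul]
    linear_combination (n : ℂ) * ht.mul_conj z z.2

theorem IsInvariantChar.IrrOver_subset (ht : IsInvariantChar A t) :
    IrrOver A t ⊆ equivariantFun A t := by
  intro psi hpsi
  refine ⟨Irr_isClassFun hpsi.1, fun s z hz => ?_⟩
  obtain ⟨V, _, _, _, rho, hrho, rfl⟩ := hpsi.1
  rw [Representation.character, Representation.character, map_mul,
    ht.rho_eq_smul hrho hpsi z hz, mul_smul_comm, mul_one, map_smul, smul_eq_mul, mul_comm]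

/-- Averaging the inner product over translations by `A` turns it into a combination of the sums `∑
t(z) conj ψ(sz)`. Each is the conjugate of the trace of `rho s` times the isotypic sum, which is
zero when `ψ` does not lie over `t`. -/
theorem IsInvariantChar.cfInner_eq_zero (ht : IsInvariantChar A t) {f psi : S → ℂ}
    (hf : f ∈ equivariantFun A t) (hpsi : psi ∈ Irr S) (hpsi' : psi ∉ IrrOver A t) :
    cfInner f psi = 0 := by
  have := Fintype.ofFinite A
  have := Fintype.ofFinite S
  have hsum : ∀ s, ∑ z : A, t z * conj (psi (s * z)) = 0 := by
    intro s
    obtain ⟨V, _, _, _, rho, hrho, rfl⟩ := hpsi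
    rcases ht.scalar_or_sum_eq_zero hrho with h | h
    · refine absurd ⟨character_mem_Irr rho hrho, fun z hz => ?_⟩ hpsi'
      rw [Representation.character, h z hz, map_smul, char_one, LinearMap.trace_one, smul_eq_mul,
        mul_comm]
    · have h1 := congrArg (fun T => conj (LinearMap.trace ℂ V (rho s * T))) h
      simp only [mul_zero, map_zero, Finset.mul_sum, map_sum, mul_smul_comm, map_smul,
        ← map_mul rho] at h1
      rw [← h1]
      refine Finset.sum_congr rfl fun z _ => ?_
      simp [Representation.character]
  have hA : (Fintype.card A : ℂ) ≠ 0 := by simp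
  rw [cfInner_eq_sum]
  suffices h : (Fintype.card A : ℂ) * ∑ s, f s * conj (psi s) = 0 by
    rw [(mul_eq_zero.1 h).resolve_left hA, mul_zero]
  calc (Fintype.card A : ℂ) * ∑ s, f s * conj (psi s)
      = ∑ z : A, ∑ s, f (s * z) * conj (psi (s * z)) := by
        rw [Finset.sum_congr rfl (g := fun _ : A => ∑ s, f s * conj (psi s))
          (s₂ := (Finset.univ : Finset A))]
        · simp
        · exact fun z _ => Equiv.sum_comp (Equiv.mulRight (z : S)) fun s => f s * conj (psi s)
    _ = ∑ s, f s * ∑ z : A, t z * conj (psi (s * z)) := by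
        rw [Finset.sum_comm]
        refine Finset.sum_congr rfl fun s _ => ?_
        rw [Finset.mul_sum]
        exact Finset.sum_congr rfl fun z _ => by rw [hf.2 s z z.2, mul_assoc]
    _ = 0 := Finset.sum_eq_zero fun s _ => by rw [hsum, mul_zero]

theorem IsInvariantChar.eq_sum_IrrOver (ht : IsInvariantChar A t) {f : S → ℂ}
    (hf : f ∈ equivariantFun A t) :
    f = ∑ psi ∈ (IrrOver_finite (A := A) (t := t)).toFinset, cfInner f psi • psi := by
  conv_lhs => rw [hf.1.eq_sum_Irr]
  symm
  refine Finset.sum_subset (fun psi h => ?_) fun psi h1 h2 => ?_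
  · simp only [Set.Finite.mem_toFinset] at h ⊢
    exact h.1
  · simp only [Set.Finite.mem_toFinset] at h1 h2
    rw [ht.cfInner_eq_zero hf h1 h2, zero_smul]

/-- By the expansion above, the characters over `t` span this space, and distinct irreducible
characters are independent. -/
theorem IsInvariantChar.encard_IrrOver (ht : IsInvariantChar A t) :
    (IrrOver A t).encard = Module.finrank ℂ (equivariantFun A t) := by
  have hspan : equivariantFun A t = Submodule.span ℂ (IrrOver A t) := by
    refine le_antisymm (fun f hf => ?_) (Submodule.span_le.2 ht.IrrOver_subset)
    rw [ht.eq_sum_IrrOver hf]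
    exact Submodule.sum_mem _ fun psi h => Submodule.smul_mem _ _
      (Submodule.subset_span ((Set.Finite.mem_toFinset _).1 h))
  have := (IrrOver_finite (A := A) (t := t)).fintype
  rw [hspan, finrank_span_set_eq_card, ← Set.coe_fintypeCard, Set.toFinset_card]
  exact Irr_linearIndependent.mono fun _ h => h.1

/-- Inflation from `S ⧸ A`, twisted by a linear character `c` of `S`. -/
theorem bijOn_twisted_inflation (c : S →* ℂ) (hc : IsInvariantChar A c) :
    Set.BijOn (fun (psi : S ⧸ A → ℂ) s => c s * psi (QuotientGroup.mk s)) (Irr (S ⧸ A))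
      (IrrOver A c) := by
  have hc0 : ∀ s, c s ≠ 0 := fun s h => by
    have h1 : c (s * s⁻¹) = 1 := by rw [mul_inv_cancel, map_one]
    rw [map_mul, h, zero_mul] at h1
    exact zero_ne_one h1
  refine ⟨?_, ?_, ?_⟩
  · rintro _ ⟨V, _, _, _, rho, hrho, rfl⟩
    let sigma : Representation ℂ S V :=
      { toFun := fun s => c s • rho (QuotientGroup.mk s)
        map_one' := by simp
        map_mul' := fun s s' => by
          rw [map_mul, QuotientGroup.mk_mul, map_mul, smul_mul_smul_comm] }
    have hchar : sigma.character = fun s => c s * rho.character (QuotientGroup.mk s) := by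
      ext s
      exact map_smul (LinearMap.trace ℂ V) _ _
    have hirr : sigma.IsIrreducible := by
      rw [isIrreducible_iff] at hrho ⊢
      refine ⟨hrho.1, fun W hW => hrho.2 W fun g v hv => ?_⟩
      obtain ⟨s, rfl⟩ := QuotientGroup.mk_surjective g
      have := W.smul_mem (c s)⁻¹ (hW s v hv)
      rwa [show sigma s v = c s • rho (QuotientGroup.mk s) v from rfl, smul_smul,
        inv_mul_cancel₀ (hc0 s), one_smul] at this
    refine ⟨?_, fun z hz => ?_⟩
    · have := character_mem_Irr sigma hirr
      rwa [hchar] at this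
    have : (QuotientGroup.mk z : S ⧸ A) = 1 := (QuotientGroup.eq_one_iff z).2 hz
    simp only [this, QuotientGroup.mk_one, map_one, one_mul]
    ring
  · intro psi _ psi' _ h
    ext g
    obtain ⟨s, rfl⟩ := QuotientGroup.mk_surjective g
    exact mul_left_cancel₀ (hc0 s) (congrFun h s)
  · intro psi hpsi
    obtain ⟨V, _, _, _, rho, hrho, rfl⟩ := hpsi.1
    have hscal := hc.rho_eq_smul hrho hpsi
    let sigma : S →* (V →ₗ[ℂ] V) :=
      { toFun := fun s => (c s)⁻¹ • rho s
        map_one' := by simp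
        map_mul' := fun s s' => by
          rw [map_mul, map_mul, smul_mul_smul_comm, mul_inv] }
    let tau : Representation ℂ (S ⧸ A) V := QuotientGroup.lift A sigma fun z hz => by
      change (c z)⁻¹ • rho z = 1
      rw [hscal z hz, smul_smul, inv_mul_cancel₀ (hc0 z), one_smul]
    have htau : ∀ s, tau (QuotientGroup.mk s) = (c s)⁻¹ • rho s := fun s => rfl
    refine ⟨tau.character, character_mem_Irr tau ?_, ?_⟩
    · rw [isIrreducible_iff] at hrho ⊢
      refine ⟨hrho.1, fun W hW => hrho.2 W fun s v hv => ?_⟩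
      have := W.smul_mem (c s) (hW (QuotientGroup.mk s) v hv)
      rwa [htau, LinearMap.smul_apply, smul_smul, mul_inv_cancel₀ (hc0 s), one_smul] at this
    · ext s
      simp only [Representation.character, htau, map_smul, smul_eq_mul]
      rw [mul_inv_cancel_left₀ (hc0 s)]

end Clifford

/-! ### Induction of class functions and the Mackey argument -/

section Induction

variable {G : Type*} [Group G]

open Classical in
/-- Extension by zero of a function on a subgroup. -/
def extendZero (H : Subgroup G) (f : H → ℂ) (g : G) : ℂ := if h : g ∈ H then f ⟨g, h⟩ else 0

theorem extendZero_coe {H : Subgroup G} (f : H → ℂ) (h : H) : extendZero H f h = f h := by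
  simp [extendZero]

theorem extendZero_of_notMem {H : Subgroup G} (f : H → ℂ) {g : G} (h : g ∉ H) :
    extendZero H f g = 0 := by
  simp [extendZero, h]

theorem sum_extendZero_mul [Fintype G] (H : Subgroup G) [Fintype H] (f : H → ℂ) (F : G → ℂ) :
    ∑ g, extendZero H f g * F g = ∑ h : H, f h * F h := by
  classical
  rw [← Finset.sum_subset
    (Finset.subset_univ (Finset.univ.map ⟨((↑) : H → G), Subtype.val_injective⟩))]
  · simp [extendZero_coe]
  · intro g _ hg
    rw [extendZero_of_notMem f, zero_mul]
    simpa using hg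

theorem induced_eq_sum [Fintype G] (H : Subgroup G) (f : H → ℂ) (g : G) :
    induced H f g = (Nat.card H : ℂ)⁻¹ * ∑ x : G, extendZero H f (x * g * x⁻¹) := by
  classical
  rw [induced, finsum_eq_sum_of_fintype]
  simp only [finsum_eq_dif, extendZero]

theorem induced_isClassFun [Finite G] (H : Subgroup G) (f : H → ℂ) :
    IsClassFun (induced H f) := by
  have := Fintype.ofFinite G
  intro g h
  rw [induced_eq_sum, induced_eq_sum,
    ← Equiv.sum_comp (Equiv.mulRight h) fun x => extendZero H f (x * g * x⁻¹)]
  simp [mul_assoc]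

theorem induced_one [Finite G] (H : Subgroup G) (f : H → ℂ) :
    induced H f 1 = (Nat.card G : ℂ) / Nat.card H * f 1 := by
  have := Fintype.ofFinite G
  rw [induced_eq_sum]
  have : extendZero H f 1 = f 1 := extendZero_coe f 1
  simp [this]
  ring

/-- Induction as a linear map. -/
def inducedHom [Finite G] (H : Subgroup G) : (H → ℂ) →ₗ[ℂ] (G → ℂ) where
  toFun := induced H
  map_add' a b := by
    have := Fintype.ofFinite G
    ext g
    simp only [induced_eq_sum, Pi.add_apply, ← mul_add, ← Finset.sum_add_distrib]
    congr 2
    ext x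
    by_cases h : x * g * x⁻¹ ∈ H <;> simp [extendZero, h]
  map_smul' r a := by
    have := Fintype.ofFinite G
    ext g
    simp only [induced_eq_sum, Pi.smul_apply, smul_eq_mul, RingHom.id_apply]
    rw [mul_left_comm, Finset.mul_sum _ _ r]
    congr 2
    ext x
    by_cases h : x * g * x⁻¹ ∈ H <;> simp [extendZero, h]

/-- Frobenius reciprocity: since `chi` is a class function, each of the `|G|` conjugates in the
induction formula contributes the same sum. -/
theorem cfInner_induced [Finite G] (H : Subgroup G) (f : H → ℂ) {chi : G → ℂ}
    (hchi : IsClassFun chi) : cfInner (induced H f) chi = cfInner f fun h => chi h := by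
  have := Fintype.ofFinite G
  have := Fintype.ofFinite H
  rw [cfInner_eq_sum, cfInner_eq_sum, ← sum_extendZero_mul H f fun g => conj (chi g)]
  have hG : (Nat.card G : ℂ) ≠ 0 := by simp
  have key : ∑ g, induced H f g * conj (chi g) =
      (Nat.card H : ℂ)⁻¹ * (Nat.card G * ∑ g, extendZero H f g * conj (chi g)) := by
    simp only [induced_eq_sum, mul_assoc, ← Finset.mul_sum, Finset.sum_mul]
    rw [Finset.sum_comm, Finset.sum_congr rfl (g := fun _ => ∑ g, extendZero H f g * conj (chi g))]
    · simp
    · intro x _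
      rw [← Equiv.sum_comp (MulAut.conj x).toEquiv fun g => extendZero H f g * conj (chi g)]
      refine Finset.sum_congr rfl fun g _ => ?_
      have h1 : chi ((MulAut.conj x).toEquiv g) = chi g := hchi g x
      rw [h1, show (MulAut.conj x).toEquiv g = x * (g * x⁻¹) from mul_assoc _ _ _]
  rw [key]
  field_simp

variable {L S : Subgroup G} {t : G → ℂ}

/-- Mackey's formula without double cosets. By reciprocity the left side is an average of terms `B
x` over `x ∈ G`; for `x ∈ S` each equals the sum defining `⟨f, f'⟩`, and for `x ∉ S` it vanishes by
`hsep`. -/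
theorem cfInner_induced_induced [Finite G] (hLS : L ≤ S)
    (ht : IsInvariantChar (L.subgroupOf S) fun s => t s)
    (hsep : ∀ x ∉ S, ∃ z ∈ L, x * z * x⁻¹ ∈ L ∧ t (x * z * x⁻¹) ≠ t z) {f f' : S → ℂ}
    (hf : f ∈ equivariantFun (L.subgroupOf S) fun s => t s)
    (hf' : f' ∈ equivariantFun (L.subgroupOf S) fun s => t s) :
    cfInner (induced S f) (induced S f') = cfInner f f' := by
  classical
  have := Fintype.ofFinite G
  have := Fintype.ofFinite S
  rw [cfInner_induced S f (induced_isClassFun S f'), cfInner_eq_sum, cfInner_eq_sum]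
  have hS : (Nat.card S : ℂ) ≠ 0 := by simp
  congr 1
  let B : G → ℂ := fun x => ∑ s : S, f s * conj (extendZero S f' (x * s * x⁻¹))
  have hB : ∀ x, B x = extendZero S (fun _ => ∑ s : S, f s * conj (f' s)) x * 1 := by
    intro x
    by_cases hx : x ∈ S
    · lift x to S using hx
      rw [extendZero_coe, mul_one]
      refine Finset.sum_congr rfl fun s _ => ?_
      have : extendZero S f' (x * s * (x : G)⁻¹) = f' (x * s * x⁻¹) :=
        extendZero_coe f' (x * s * x⁻¹)
      rw [this, hf'.1]
    · rw [extendZero_of_notMem _ hx, zero_mul]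
      obtain ⟨z, hz, hxz, hne⟩ := hsep x hx
      -- The substitution `s ↦ s z` multiplies `B x` by `t(z) conj t(x z x⁻¹)`. Both values have
      -- modulus 1 and they differ, so this factor is not 1 and `B x = 0`.
      have h1 : B x = t z * conj (t (x * z * x⁻¹)) * B x := by
        conv_lhs => simp only [B]
        rw [← Equiv.sum_comp (Equiv.mulRight (⟨z, hLS hz⟩ : S)), Finset.mul_sum]
        refine Finset.sum_congr rfl fun s _ => ?_
        have e1 : f (s * ⟨z, hLS hz⟩) = f s * t z :=
          hf.2 s ⟨z, hLS hz⟩ (Subgroup.mem_subgroupOf.2 hz)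
        have e2 : extendZero S f' (x * (s * z) * x⁻¹) =
            extendZero S f' (x * s * x⁻¹) * t (x * z * x⁻¹) := by
          have e3 : x * (s * z) * x⁻¹ = x * s * x⁻¹ * (x * z * x⁻¹) := by group
          rw [e3]
          by_cases hs : x * s * x⁻¹ ∈ S
          · have e4 := extendZero_coe f' (⟨x * s * x⁻¹, hs⟩ * ⟨x * z * x⁻¹, hLS hxz⟩)
            have e5 := extendZero_coe f' ⟨x * s * x⁻¹, hs⟩
            refine e4.trans ?_
            rw [e5]
            exact hf'.2 _ ⟨x * z * x⁻¹, hLS hxz⟩ (Subgroup.mem_subgroupOf.2 hxz)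
          · rw [extendZero_of_notMem f' hs, zero_mul, extendZero_of_notMem]
            rwa [S.mul_mem_cancel_right (hLS hxz)]
        simp only [Equiv.coe_mulRight, e1, Subgroup.coe_mul, e2, map_mul]
        ring
      by_contra h0
      have h2 : t z * conj (t (x * z * x⁻¹)) = 1 := by
        apply mul_right_cancel₀ h0
        rw [← h1, one_mul]
      have h3 := ht.mul_conj ⟨x * z * x⁻¹, hLS hxz⟩ (Subgroup.mem_subgroupOf.2 hxz)
      simp only at h3
      apply hne
      linear_combination (t z) * h3 - (t (x * z * x⁻¹)) * h2
  calc ∑ s : S, f s * conj (induced S f' s)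
      = (Nat.card S : ℂ)⁻¹ * ∑ x, B x := by
        simp only [B, induced_eq_sum, map_mul, map_inv₀, map_sum, Complex.conj_natCast]
        rw [Finset.sum_comm, Finset.mul_sum]
        refine Finset.sum_congr rfl fun s _ => ?_
        rw [← Finset.mul_sum]
        ring
    _ = _ := by
        simp only [hB]
        rw [sum_extendZero_mul S _ fun _ => 1]
        simp [Nat.card_eq_fintype_card]

open Classical in
/-- The function on `S` induced from the invariant linear character `t` of `L`. -/
def normalInduced (L S : Subgroup G) (t : G → ℂ) (s : S) : ℂ :=
  if (s : G) ∈ L then (Nat.card S : ℂ) / Nat.card L * t s else 0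

theorem normalInduced_mem [(L.subgroupOf S).Normal]
    (ht : IsInvariantChar (L.subgroupOf S) fun s => t s) :
    normalInduced L S t ∈ equivariantFun (L.subgroupOf S) fun s => t s := by
  constructor
  · intro g h
    have hiff : (h * g * h⁻¹ : S) ∈ L.subgroupOf S ↔ g ∈ L.subgroupOf S :=
      (Subgroup.Normal.mem_comm_iff inferInstance).trans (by rw [inv_mul_cancel_left])
    by_cases hg : g ∈ L.subgroupOf S
    · have h1 : ((h * g * h⁻¹ : S) : G) ∈ L := hiff.2 hg
      have h2 : (g : G) ∈ L := hg
      have h3 : t ((h * g * h⁻¹ : S) : G) = t g := ht.conj_eq h g hg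
      simp only [normalInduced, if_pos h1, if_pos h2, h3]
    · have h1 : ((h * g * h⁻¹ : S) : G) ∉ L := fun h' => hg (hiff.1 h')
      have h2 : (g : G) ∉ L := hg
      simp only [normalInduced, if_neg h1, if_neg h2]
  · intro s z hz
    have hz' : (z : G) ∈ L := hz
    have hiff : ((s * z : S) : G) ∈ L ↔ (s : G) ∈ L := L.mul_mem_cancel_right hz'
    by_cases hs : (s : G) ∈ L
    · have h3 : t ((s * z : S) : G) = t s * t z := ht.apply_mul s hs z hz
      simp only [normalInduced, if_pos (hiff.2 hs), if_pos hs, h3]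
      ring
    · simp only [normalInduced, if_neg (fun h => hs (hiff.1 h)), if_neg hs, zero_mul]

theorem extendZero_normalInduced (hLS : L ≤ S) (g : G) :
    extendZero S (normalInduced L S t) g =
      (Nat.card S : ℂ) / Nat.card L * extendZero L (fun z => t z) g := by
  by_cases hL : g ∈ L
  · simp [extendZero, normalInduced, hL, hLS hL]
  · by_cases hS : g ∈ S <;> simp [extendZero, normalInduced, hL, hS]

variable [Finite G]

/-- Transitivity of induction, since `normalInduced` is the character of `S` induced from `t` on
`L`. -/
theorem induced_normalInduced (hLS : L ≤ S) :
    induced S (normalInduced L S t) = induced L fun z => t z := by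
  have := Fintype.ofFinite G
  ext g
  have hS : (Nat.card S : ℂ) ≠ 0 := Nat.cast_ne_zero.2 Nat.card_pos.ne'
  simp only [induced_eq_sum, extendZero_normalInduced hLS, ← Finset.mul_sum]
  rw [← mul_assoc, div_eq_mul_inv, inv_mul_cancel_left₀ hS]

theorem cfInner_normalInduced (hLS : L ≤ S)
    (ht : IsInvariantChar (L.subgroupOf S) fun s => t s)
    {psi : S → ℂ} (hpsi : psi ∈ IrrOver (L.subgroupOf S) fun s => t s) :
    cfInner (normalInduced L S t) psi = psi 1 := by
  have := Fintype.ofFinite G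
  have := Fintype.ofFinite S
  have := Fintype.ofFinite L
  have hS : (Nat.card S : ℂ) ≠ 0 := by simp
  have hL : (Nat.card L : ℂ) ≠ 0 := by simp
  obtain ⟨n, -, hn⟩ := Irr_one_pos hpsi.1
  have e1 : ∑ s : S, normalInduced L S t s * conj (psi s) =
      ∑ s : S, normalInduced L S t s * conj (extendZero S psi s) := by
    simp only [extendZero_coe]
  rw [cfInner_eq_sum, e1, ← sum_extendZero_mul S _ fun g => conj (extendZero S psi g)]
  simp only [extendZero_normalInduced hLS, mul_assoc, ← Finset.mul_sum]
  rw [sum_extendZero_mul L _ fun g => conj (extendZero S psi g),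
    Finset.sum_congr rfl (g := fun _ => (n : ℂ))]
  · rw [hn]
    simp only [Finset.sum_const, Finset.card_univ, nsmul_eq_mul, ← Nat.card_eq_fintype_card]
    field_simp
  · intro z _
    have e2 : extendZero S psi z = psi ⟨z, hLS z.2⟩ := extendZero_coe psi ⟨z, hLS z.2⟩
    have e3 := hpsi.2 ⟨z, hLS z.2⟩ z.2
    have e4 := ht.mul_conj ⟨z, hLS z.2⟩ z.2
    simp only at e3 e4
    rw [e2, e3, map_mul, hn, Complex.conj_natCast]
    linear_combination (n : ℂ) * e4

/-- The induced function has norm 1 and, by reciprocity, natural multiplicities. -/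
theorem induced_mem_Irr (hLS : L ≤ S) [(L.subgroupOf S).Normal]
    (ht : IsInvariantChar (L.subgroupOf S) fun s => t s)
    (hsep : ∀ x ∉ S, ∃ z ∈ L, x * z * x⁻¹ ∈ L ∧ t (x * z * x⁻¹) ≠ t z) {psi : S → ℂ}
    (hpsi : psi ∈ IrrOver (L.subgroupOf S) fun s => t s) : induced S psi ∈ Irr G := by
  refine (induced_isClassFun S psi).mem_Irr_of_cfInner_self (fun chi hchi => ?_) ?_
  · rw [cfInner_induced S psi (Irr_isClassFun hchi)]
    exact exists_cfInner_restrict_eq_natCast S hpsi.1 hchi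
  · rw [cfInner_induced_induced hLS ht hsep (ht.IrrOver_subset hpsi) (ht.IrrOver_subset hpsi),
      cfInner_self_of_mem_Irr hpsi.1]

/-- Induction from `S` to `G` is a bijection from the irreducible characters of `S` over `t` onto
the irreducible constituents of the character of `G` induced from `t`. -/
theorem bijOn_induced_constituents (hLS : L ≤ S) [(L.subgroupOf S).Normal]
    (ht : IsInvariantChar (L.subgroupOf S) fun s => t s)
    (hsep : ∀ x ∉ S, ∃ z ∈ L, x * z * x⁻¹ ∈ L ∧ t (x * z * x⁻¹) ≠ t z) :
    Set.BijOn (induced S) (IrrOver (L.subgroupOf S) fun s => t s)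
      (constituents (induced L fun z => t z)) := by
  refine ⟨fun psi hpsi => ⟨induced_mem_Irr hLS ht hsep hpsi, ?_⟩, fun psi hpsi psi' hpsi' h => ?_,
    fun chi hchi => ?_⟩
  · rw [← induced_normalInduced hLS, cfInner_induced_induced hLS ht hsep (normalInduced_mem ht)
      (ht.IrrOver_subset hpsi), cfInner_normalInduced hLS ht hpsi]
    obtain ⟨n, hn, hn1⟩ := Irr_one_pos hpsi.1
    rw [hn1]
    exact_mod_cast hn
  · by_contra hne
    have h1 := cfInner_induced_induced hLS ht hsep (ht.IrrOver_subset hpsi)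
      (ht.IrrOver_subset hpsi')
    rw [cfInner_eq_zero_of_ne hpsi.1 hpsi'.1 hne, ← h,
      cfInner_self_of_mem_Irr (induced_mem_Irr hLS ht hsep hpsi)] at h1
    exact one_ne_zero h1
  -- Surjectivity: expanding `normalInduced` over `IrrOver` and inducing, some induced irreducible
  -- character has nonzero inner product with `chi`, hence equals it.
  · have h1 := hchi.2.ne'
    rw [← induced_normalInduced hLS, ht.eq_sum_IrrOver (normalInduced_mem ht)] at h1
    have h2 := map_sum (inducedHom S) (fun psi => cfInner (normalInduced L S t) psi • psi)
      (IrrOver_finite (A := L.subgroupOf S) (t := fun s => t s)).toFinset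
    change induced S _ = _ at h2
    rw [h2, cfInner_sum_left] at h1
    obtain ⟨psi, hpsi, hne⟩ := Finset.exists_ne_zero_of_sum_ne_zero h1
    rw [Set.Finite.mem_toFinset] at hpsi
    rw [map_smul, cfInner_smul_left] at hne
    refine ⟨psi, hpsi, ?_⟩
    by_contra hne'
    exact right_ne_zero_of_mul hne
      (cfInner_eq_zero_of_ne (induced_mem_Irr hLS ht hsep hpsi) hchi.1 hne')

end Induction

end AlgebraGroups

end

noncomputable section

namespace AlgebraGroups

set_option linter.unusedSectionVars false

open scoped ComplexConjugate

/-! ### Actions of the algebra group on its algebra and on the dual -/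

section AlgGroupStructure

theorem finite_algGroup {N : Type*} [Finite N] : Finite (AlgGroup N) :=
  Finite.of_injective AlgGroup.val fun _ _ h => AlgGroup.ext h

theorem ncard_range_mul_card {H X : Type*} [Group H] (A : Subgroup H) {phi : H → X}
    (hphi : ∀ g h, phi g = phi h ↔ g⁻¹ * h ∈ A) :
    (Set.range phi).ncard * Nat.card A = Nat.card H := by
  let phi' : H ⧸ A → X := Quotient.lift phi fun g h hgh =>
    (hphi g h).2 (QuotientGroup.leftRel_apply.1 hgh)
  have hinj : Function.Injective phi' := by
    rintro ⟨g⟩ ⟨h⟩ hgh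
    exact QuotientGroup.eq.2 ((hphi g h).1 hgh)
  have hrange : Set.range phi = Set.range phi' := by
    ext x
    constructor
    · rintro ⟨g, rfl⟩
      exact ⟨QuotientGroup.mk g, rfl⟩
    · rintro ⟨⟨g⟩, rfl⟩
      exact ⟨g, rfl⟩
  rw [hrange, ← Set.image_univ, Set.ncard_image_of_injective _ hinj, Set.ncard_univ,
    ← Subgroup.card_eq_card_quotient_mul_card_subgroup]

variable {F : Type*} [Field F] {N : Type*} [NonUnitalRing N] [Module F N]

/-- A nontrivial additive character of a field is primitive. Thus `θ`, tested on all scalar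
multiples, separates elements of `F`. -/
theorem exists_smul_apply_ne {θ : AddChar F ℂ} (hθ : θ ≠ 1) {a b : F} (hab : a ≠ b) :
    ∃ c : F, θ (c * a) ≠ θ (c * b) := by
  by_contra! h
  refine AddChar.IsPrimitive.of_ne_one hθ (sub_ne_zero.2 hab) ?_
  ext x
  rw [AddChar.mulShift_apply, AddChar.one_apply, sub_mul, AddChar.map_sub_eq_div, mul_comm a,
    mul_comm b, h, div_self]
  exact (AddChar.val_isUnit θ (x * b)).ne_zero

section Products

variable [IsScalarTower F N N] [SMulCommClass F N N]

theorem lmul_apply (g : AlgGroup N) (X : N) : lmul (F := F) g X = X + g.val * X := rfl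

theorem rmul_apply (g : AlgGroup N) (X : N) : rmul (F := F) g X = X + X * g.val := rfl

theorem lmul_mul (g h : AlgGroup N) (X : N) :
    lmul (F := F) (g * h) X = lmul (F := F) g (lmul (F := F) h X) := by
  simp only [lmul_apply, AlgGroup.mul_val]
  noncomm_ring

theorem rmul_mul (g h : AlgGroup N) (X : N) :
    rmul (F := F) (g * h) X = rmul (F := F) h (rmul (F := F) g X) := by
  simp only [rmul_apply, AlgGroup.mul_val]
  noncomm_ring

theorem lmul_one (X : N) : lmul (F := F) 1 X = X := by
  simp [lmul_apply, AlgGroup.one_val]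

theorem rmul_one (X : N) : rmul (F := F) 1 X = X := by
  simp [rmul_apply, AlgGroup.one_val]

variable [IsNilpotentRing N]

theorem Ad_apply (g : AlgGroup N) (X : N) :
    Ad (F := F) g X = (g * ⟨X⟩ * g⁻¹ : AlgGroup N).val := by
  rw [AlgGroup.conj_val]
  change X + X * g⁻¹.val + g.val * (X + X * g⁻¹.val) = _
  rw [mul_add]
  abel

theorem Ad_one (X : N) : Ad (F := F) 1 X = X := by
  rw [Ad_apply]
  simp

theorem Ad_mul (g h : AlgGroup N) (X : N) :
    Ad (F := F) (g * h) X = Ad (F := F) g (Ad (F := F) h X) := by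
  simp only [Ad_apply]
  rw [show (⟨(h * ⟨X⟩ * h⁻¹ : AlgGroup N).val⟩ : AlgGroup N) = h * ⟨X⟩ * h⁻¹ from rfl, mul_inv_rev]
  simp only [mul_assoc]

/-- The coadjoint action of `1 + h` on the dual of `h`. -/
def coad (h : NonUnitalSubalgebra F N) (g : algSubgroup h) (kappa : Module.Dual F h.toSubmodule) :
    Module.Dual F h.toSubmodule :=
  kappa.comp ((Ad (g : AlgGroup N)).restrict fun _ hX => Ad_mem h g hX)

theorem coad_apply (h : NonUnitalSubalgebra F N) (g : algSubgroup h)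
    (kappa : Module.Dual F h.toSubmodule) (X : h.toSubmodule) :
    coad h g kappa X = kappa ⟨Ad (F := F) (g : AlgGroup N) X, Ad_mem h g X.2⟩ := rfl

theorem coad_one (h : NonUnitalSubalgebra F N) (kappa : Module.Dual F h.toSubmodule) :
    coad h 1 kappa = kappa := by
  ext X
  rw [coad_apply]
  congr 1
  ext
  exact Ad_one _

theorem coad_coad (h : NonUnitalSubalgebra F N) (g g' : algSubgroup h)
    (kappa : Module.Dual F h.toSubmodule) :
    coad h g' (coad h g kappa) = coad h (g * g') kappa := by
  ext X
  rw [coad_apply, coad_apply, coad_apply]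
  congr 1
  ext
  exact (Ad_mul _ _ _).symm

theorem coadjointOrbit_eq (h : NonUnitalSubalgebra F N) (kappa : Module.Dual F h.toSubmodule) :
    coadjointOrbit h kappa = Set.range fun g => coad h g kappa := rfl

theorem mem_coadjointOrbit_self (h : NonUnitalSubalgebra F N)
    (kappa : Module.Dual F h.toSubmodule) : kappa ∈ coadjointOrbit h kappa :=
  ⟨1, coad_one h kappa⟩

theorem coadjointOrbit_coad (h : NonUnitalSubalgebra F N) (g : algSubgroup h)
    (kappa : Module.Dual F h.toSubmodule) :
    coadjointOrbit h (coad h g kappa) = coadjointOrbit h kappa := by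
  rw [coadjointOrbit_eq, coadjointOrbit_eq]
  ext nu
  constructor
  · rintro ⟨g', rfl⟩
    exact ⟨g * g', (coad_coad h g g' kappa).symm⟩
  · rintro ⟨g', rfl⟩
    exact ⟨g⁻¹ * g', by simp only [coad_coad, mul_inv_cancel_left]⟩

/-- The coadjoint action of a fixed element, as a permutation. -/
def coadEquiv (h : NonUnitalSubalgebra F N) (g : algSubgroup h) :
    Module.Dual F h.toSubmodule ≃ Module.Dual F h.toSubmodule where
  toFun := coad h g
  invFun := coad h g⁻¹
  left_inv kappa := by rw [coad_coad, mul_inv_cancel, coad_one]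
  right_inv kappa := by rw [coad_coad, inv_mul_cancel, coad_one]

end Products

/-! ### Linear algebra of `𝔩_λ`, `𝔰_λ` and the one-sided orbits -/

section Functionals

variable [IsScalarTower F N N] (lam : Module.Dual F N)

theorem mem_lAlg {X : N} : X ∈ lAlg lam ↔ ∀ Y, lam (X * Y) = 0 := Iff.rfl

theorem mem_sAlg {X : N} : X ∈ sAlg lam ↔ ∀ Y ∈ lAlg lam, lam (X * Y) = 0 := Iff.rfl

theorem lAlg_le_sAlg {X : N} (h : X ∈ lAlg lam) : X ∈ sAlg lam := fun Y _ => h Y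

variable [SMulCommClass F N N]

/-- The functional `X ↦ λ (X Y)`, depending linearly on `Y`. -/
def rightTranslate : N →ₗ[F] Module.Dual F N where
  toFun Y := lam.comp (LinearMap.mulRight F Y)
  map_add' Y Y' := by ext X; simp [mul_add]
  map_smul' c Y := by ext X; simp [mul_smul_comm]

theorem rightTranslate_apply (X Y : N) : rightTranslate lam Y X = lam (X * Y) := rfl

variable [Module.Finite F N]

/-- `𝔩_λ` is the common kernel of the functionals `X ↦ λ(XY)`; in finite dimension the double
annihilator returns their space. -/
theorem range_rightTranslate :
    LinearMap.range (rightTranslate lam) = (lAlg lam).toSubmodule.dualAnnihilator := by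
  have : (lAlg lam).toSubmodule = (LinearMap.range (rightTranslate lam)).dualCoannihilator := by
    ext X
    rw [Submodule.mem_dualCoannihilator]
    constructor
    · rintro hX _ ⟨Y, rfl⟩
      exact hX Y
    · exact fun h Y => h _ ⟨Y, rfl⟩
  rw [this, Subspace.dualCoannihilator_dualAnnihilator_eq]

theorem exists_eq_mul_right {phi : Module.Dual F N} (h : ∀ X ∈ lAlg lam, phi X = 0) :
    ∃ Y, ∀ X, phi X = lam (X * Y) := by
  have : phi ∈ (lAlg lam).toSubmodule.dualAnnihilator :=
    (Submodule.mem_dualAnnihilator _).2 h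
  rw [← range_rightTranslate] at this
  obtain ⟨Y, rfl⟩ := this
  exact ⟨Y, fun X => rfl⟩

variable [IsNilpotentRing N]

/-- Every `Y` gives a group element `1 + Y`, so `λG` is the full affine space of functionals `X ↦
λ(X) + λ(XY)`, that is, `λ` plus the annihilator of `𝔩_λ`. -/
theorem mem_rightOrbit_iff {nu : Module.Dual F N} :
    nu ∈ rightOrbit lam ↔ ∀ X ∈ lAlg lam, nu X = lam X := by
  constructor
  · rintro ⟨g, rfl⟩ X hX
    change lam (X + X * g⁻¹.val) = lam X
    rw [map_add, hX, add_zero]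
  · intro h
    obtain ⟨Y, hY⟩ := exists_eq_mul_right lam (phi := nu - lam) fun X hX => by
      rw [LinearMap.sub_apply, h X hX, sub_self]
    refine ⟨(⟨Y⟩ : AlgGroup N)⁻¹, ?_⟩
    ext X
    change lam (X + X * (⟨Y⟩ : AlgGroup N)⁻¹⁻¹.val) = nu X
    rw [inv_inv, map_add, ← hY X, LinearMap.sub_apply, add_sub_cancel]

theorem mem_SGroup_iff {g : AlgGroup N} :
    g ∈ SGroup lam ↔ ∀ X ∈ lAlg lam, lam (lmul (F := F) g X) = lam X := by
  rw [mem_algSubgroup, mem_sAlg]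
  simp only [lmul_apply, map_add, add_eq_left]

theorem mem_SGroup_iff_leftTranslate_mem {g : AlgGroup N} :
    g ∈ SGroup lam ↔ lam.comp (lmul g⁻¹) ∈ rightOrbit lam := by
  rw [← inv_mem_iff, mem_SGroup_iff, mem_rightOrbit_iff]
  rfl

theorem leftTranslate_eq_iff (g h : AlgGroup N) :
    lam.comp (lmul g⁻¹) = lam.comp (lmul h⁻¹) ↔ g⁻¹ * h ∈ LGroup lam := by
  rw [mem_algSubgroup, mem_lAlg]
  constructor
  · intro e Y
    have e1 := LinearMap.congr_fun e (lmul (F := F) h Y)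
    rw [LinearMap.comp_apply, LinearMap.comp_apply, ← lmul_mul, ← lmul_mul, inv_mul_cancel,
      lmul_one, lmul_apply, map_add] at e1
    exact add_eq_left.1 e1
  · intro e
    ext X
    have e1 : lmul (F := F) g⁻¹ X = lmul (F := F) (g⁻¹ * h) (lmul (F := F) h⁻¹ X) := by
      rw [← lmul_mul, mul_inv_cancel_right]
    rw [LinearMap.comp_apply, LinearMap.comp_apply, e1, lmul_apply _ (lmul (F := F) h⁻¹ X),
      map_add, e, add_zero]

theorem LGroup_le_SGroup : LGroup lam ≤ SGroup lam := fun _ h => lAlg_le_sAlg lam h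

/-- `L` is the stabilizer of `λ` under the left action, and `gλ` lies in `λG` exactly for `g ∈ S`.
The two cardinalities are therefore `|S| / |L|` and `|G| / |L|`. -/
theorem orbitRatio_eq [Finite N] :
    orbitRatio lam = (Nat.card (SGroup lam) : ℂ) / Nat.card (AlgGroup N) := by
  have := finite_algGroup (N := N)
  have h1 := ncard_range_mul_card (LGroup lam) (leftTranslate_eq_iff lam)
  have h2 := ncard_range_mul_card ((LGroup lam).subgroupOf (SGroup lam))
    (phi := fun g : SGroup lam => lam.comp (lmul (g : AlgGroup N)⁻¹))
    fun g h => leftTranslate_eq_iff lam g h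
  have h3 : leftOrbit lam ∩ rightOrbit lam =
      Set.range fun g : SGroup lam => lam.comp (lmul (g : AlgGroup N)⁻¹) := by
    ext nu
    constructor
    · rintro ⟨⟨g, rfl⟩, hg⟩
      exact ⟨⟨g, (mem_SGroup_iff_leftTranslate_mem lam).2 hg⟩, rfl⟩
    · rintro ⟨g, rfl⟩
      exact ⟨⟨g, rfl⟩, (mem_SGroup_iff_leftTranslate_mem lam).1 g.2⟩
  rw [Nat.card_congr (Subgroup.subgroupOfEquivOfLe (LGroup_le_SGroup lam)).toEquiv, ← h3] at h2
  change (leftOrbit lam).ncard * _ = _ at h1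
  have hL : (Nat.card (LGroup lam) : ℂ) ≠ 0 := Nat.cast_ne_zero.2 Nat.card_pos.ne'
  rw [orbitRatio, ← h1, ← h2]
  push_cast
  rw [mul_div_mul_right _ _ hL]

theorem mem_restrictedOrbit_iff {kappa : Module.Dual F (sAlg lam).toSubmodule} :
    kappa ∈ restrictedOrbit lam ↔
      ∀ X : (sAlg lam).toSubmodule, (X : N) ∈ lAlg lam → kappa X = lam X := by
  constructor
  · rintro ⟨nu, hnu, rfl⟩ X hX
    exact (mem_rightOrbit_iff lam).1 hnu X hX
  · intro h
    obtain ⟨nu, rfl⟩ := LinearMap.exists_extend kappa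
    exact ⟨nu, (mem_rightOrbit_iff lam).2 fun X hX => h ⟨X, lAlg_le_sAlg lam hX⟩ hX, rfl⟩

theorem coad_mem_restrictedOrbit {kappa : Module.Dual F (sAlg lam).toSubmodule}
    (h : kappa ∈ restrictedOrbit lam) (g : SGroup lam) :
    coad (sAlg lam) g kappa ∈ restrictedOrbit lam := by
  rw [mem_restrictedOrbit_iff] at h ⊢
  intro X hX
  have h1 := conj_mem_lAlg lam g.2 (x := ⟨X⟩) hX
  have h2 : Ad (F := F) (g : AlgGroup N) X ∈ lAlg lam := by
    rw [Ad_apply]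
    exact h1.1
  rw [coad_apply, h _ h2]
  exact (congrArg lam (Ad_apply _ _)).trans h1.2

/-- If the functionals `λ` and `X ↦ λ (g X)` agree on the intersection of `𝔩_λ` with its analogue
for the second functional, then `g` lies in `S_λ`. -/
theorem mem_SGroup_of_forall {g : AlgGroup N}
    (h : ∀ X ∈ lAlg lam, lmul (F := F) g X ∈ lAlg lam → lam (lmul (F := F) g X) = lam X) :
    g ∈ SGroup lam := by
  set mu : Module.Dual F N := lam.comp (lmul g) with hmu
  have hmem : ∀ X, X ∈ lAlg mu ↔ lmul (F := F) g X ∈ lAlg lam := by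
    intro X
    rw [mem_lAlg, mem_lAlg]
    refine forall_congr' fun Y => ?_
    rw [hmu, LinearMap.comp_apply, lmul_apply, lmul_apply, add_mul, mul_assoc]
  have h1 : mu - lam ∈
      ((lAlg lam).toSubmodule ⊓ (lAlg mu).toSubmodule).dualAnnihilator := by
    rw [Submodule.mem_dualAnnihilator]
    rintro X ⟨hX, hX'⟩
    rw [LinearMap.sub_apply, sub_eq_zero]
    exact h X hX ((hmem X).1 hX')
  -- The annihilator of the intersection is a sum of two annihilators, each consisting of right
  -- translates of `lam` or of `mu`.
  rw [Subspace.dualAnnihilator_inf_eq, ← range_rightTranslate, ← range_rightTranslate,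
    Submodule.mem_sup] at h1
  obtain ⟨_, ⟨Y, rfl⟩, _, ⟨Z, rfl⟩, hYZ⟩ := h1
  -- Rearranged, `μ(X(1 - Z)) = λ(X(1 + Y))`. As `1 - Z` is invertible, `μ` lies in `λG`, so it
  -- agrees with `λ` on `𝔩_λ`.
  have h2 : ∀ X, mu (rmul (F := F) ⟨-Z⟩ X) = lam (rmul (F := F) ⟨Y⟩ X) := by
    intro X
    have := LinearMap.congr_fun hYZ X
    simp only [LinearMap.add_apply, rightTranslate_apply, LinearMap.sub_apply] at this
    simp only [rmul_apply, map_add, mul_neg, map_neg]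
    linear_combination -this
  rw [mem_SGroup_iff]
  intro X hX
  have h3 := h2 (rmul (F := F) (⟨-Z⟩ : AlgGroup N)⁻¹ X)
  rw [← rmul_mul, ← rmul_mul, inv_mul_cancel, rmul_one] at h3
  change mu X = _
  rw [h3, rmul_apply, map_add, hX, add_zero]

end Functionals

/-! ### The linear character `θ_λ` and its conjugates -/

section ThetaFun

variable [Finite F] [IsScalarTower F N N] [SMulCommClass F N N] [IsNilpotentRing N]
  (θ : AddChar F ℂ) (lam : Module.Dual F N)

theorem thetaFun_isInvariantChar :
    IsInvariantChar ((LGroup lam).subgroupOf (SGroup lam)) fun s => thetaFun θ lam s where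
  conj_eq s z hz := congrArg θ (conj_mem_lAlg lam s.2 hz).2
  apply_mul z hz w _ := by
    have h : lam ((z : AlgGroup N).val * (w : AlgGroup N).val) = 0 := hz _
    change θ (lam ((z : AlgGroup N).val + (w : AlgGroup N).val +
      (z : AlgGroup N).val * (w : AlgGroup N).val)) = _
    rw [map_add lam, map_add lam, h, add_zero, AddChar.map_add_eq_mul]
    rfl
  mul_conj z _ := by
    rw [thetaFun, ← AddChar.map_neg_eq_conj, ← AddChar.map_add_eq_mul, add_neg_cancel,
      AddChar.map_zero_eq_one]

variable [Module.Finite F N] {θ}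

/-- If `xX ∈ 𝔩_λ`, the right factor `x⁻¹` does not affect the value of `λ`, so `λ(xXx⁻¹) = λ(xX)`.
The previous criterion supplies `X` with `λ(xX) ≠ λ(X)`, and rescaling `X` makes `θ` see the
difference. -/
theorem exists_thetaFun_conj_ne (hθ : θ ≠ 1) {x : AlgGroup N} (hx : x ∉ SGroup lam) :
    ∃ z ∈ LGroup lam, x * z * x⁻¹ ∈ LGroup lam ∧
      thetaFun θ lam (x * z * x⁻¹) ≠ thetaFun θ lam z := by
  have h1 := mt (mem_SGroup_of_forall lam) hx
  push Not at h1
  obtain ⟨X, hX, hxX, hne⟩ := h1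
  obtain ⟨c, hc⟩ := exists_smul_apply_ne hθ hne
  have hval : (x * ⟨c • X⟩ * x⁻¹ : AlgGroup N).val =
      c • (lmul (F := F) x X + lmul (F := F) x X * x⁻¹.val) := by
    rw [AlgGroup.conj_val, lmul_apply]
    simp only [smul_mul_assoc, mul_smul_comm, ← smul_add, add_mul, mul_assoc]
    congr 1
    abel
  have hmem : lmul (F := F) x X * x⁻¹.val ∈ lAlg lam := fun Y => by
    rw [mul_assoc]; exact hxX _
  refine ⟨⟨c • X⟩, (lAlg lam).toSubmodule.smul_mem c hX, ?_, ?_⟩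
  · rw [mem_algSubgroup, hval]
    exact (lAlg lam).toSubmodule.smul_mem c (add_mem hxX hmem)
  · rw [thetaFun, thetaFun, hval, map_smul lam, map_add lam, hxX, add_zero, map_smul lam]
    exact hc

end ThetaFun

end AlgGroupStructure

end AlgebraGroups

end

noncomputable section

namespace AlgebraGroups

set_option linter.unusedSectionVars false

open scoped ComplexConjugate

/-! ### Fourier transform on `𝔰_λ` and the count of coadjoint orbits -/

section Fourier

variable {F : Type*} [Field F] {N : Type*} [NonUnitalRing N] [Module F N] [IsScalarTower F N N]
  [SMulCommClass F N N] [IsNilpotentRing N]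

/-- The element `g - 1` of `h` for `g` in `1 + h`. -/
def subOne (h : NonUnitalSubalgebra F N) (g : algSubgroup h) : h.toSubmodule :=
  ⟨(g : AlgGroup N).val, g.2⟩

theorem coe_subOne (h : NonUnitalSubalgebra F N) (g : algSubgroup h) :
    (subOne h g : N) = (g : AlgGroup N).val := rfl

/-- The bijection `g ↦ g - 1` from `1 + h` to `h`. -/
def subOneEquiv (h : NonUnitalSubalgebra F N) : algSubgroup h ≃ h.toSubmodule where
  toFun := subOne h
  invFun X := ⟨⟨X⟩, X.2⟩
  left_inv _ := rfl
  right_inv _ := rfl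

theorem coad_subOne (h : NonUnitalSubalgebra F N) (g x : algSubgroup h)
    (kappa : Module.Dual F h.toSubmodule) :
    coad h g kappa (subOne h x) = kappa (subOne h (g * x * g⁻¹)) := by
  rw [coad_apply]
  congr 1
  ext
  exact Ad_apply _ _

variable [Finite F] [Module.Finite F N] (θ : AddChar F ℂ)

instance finite_dual (W : Submodule F N) : Finite (Module.Dual F W) :=
  Module.finite_of_finite F

/-- The Fourier transform from functions on the dual of `h` to functions on `1 + h`. -/
def fourier (h : NonUnitalSubalgebra F N) :
    (Module.Dual F h.toSubmodule → ℂ) →ₗ[ℂ] (algSubgroup h → ℂ) :=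
  have := Fintype.ofFinite (Module.Dual F h.toSubmodule)
  Fintype.linearCombination ℂ fun kappa g => θ (kappa (subOne h g))

theorem fourier_apply (h : NonUnitalSubalgebra F N) [Fintype (Module.Dual F h.toSubmodule)]
    (c : Module.Dual F h.toSubmodule → ℂ) (g : algSubgroup h) :
    fourier θ h c g = ∑ kappa, c kappa * θ (kappa (subOne h g)) := by
  rw [fourier, Fintype.linearCombination_apply, Finset.sum_apply]
  simp only [Pi.smul_apply, smul_eq_mul]
  exact Finset.sum_congr (by ext; simp) fun _ _ => rfl

variable {θ}

/-- Distinct functionals give distinct additive characters, and distinct characters are linearly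
independent. -/
theorem fourier_injective (hθ : θ ≠ 1) (h : NonUnitalSubalgebra F N) :
    Function.Injective (fourier θ h) := by
  have := Fintype.ofFinite (Module.Dual F h.toSubmodule)
  have hfin : Finite h.toSubmodule := Module.finite_of_finite F
  let chi : Module.Dual F h.toSubmodule → AddChar h.toSubmodule ℂ := fun kappa =>
    θ.compAddMonoidHom kappa.toAddMonoidHom
  have hchi : Function.Injective chi := by
    intro kappa kappa' e
    ext X
    by_contra hne
    obtain ⟨c, hc⟩ := exists_smul_apply_ne hθ hne
    have e1 := DFunLike.congr_fun e (c • X)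
    change θ (kappa (c • X)) = θ (kappa' (c • X)) at e1
    rw [map_smul kappa, map_smul kappa'] at e1
    exact hc e1
  have hli := (AddChar.linearIndependent h.toSubmodule ℂ).comp chi hchi
  rw [Fintype.linearIndependent_iff] at hli
  rw [injective_iff_map_eq_zero]
  intro c hc
  ext kappa
  refine hli c ?_ kappa
  ext X
  have := congrFun hc ((subOneEquiv h).symm X)
  rw [fourier_apply] at this
  rw [Finset.sum_apply]
  exact this

theorem fourier_surjective (hθ : θ ≠ 1) (h : NonUnitalSubalgebra F N) :
    Function.Surjective (fourier θ h) := by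
  have := Fintype.ofFinite (Module.Dual F h.toSubmodule)
  have hfin : Finite h.toSubmodule := Module.finite_of_finite F
  have : Finite (algSubgroup h) := Finite.of_equiv _ (subOneEquiv h).symm
  have := Fintype.ofFinite (algSubgroup h)
  refine (LinearMap.injective_iff_surjective_of_finrank_eq_finrank ?_).1 (fourier_injective hθ h)
  rw [Module.finrank_fintype_fun_eq_card, Module.finrank_fintype_fun_eq_card,
    ← Nat.card_eq_fintype_card, ← Nat.card_eq_fintype_card, Nat.card_congr (subOneEquiv h),
    Module.natCard_eq_pow_finrank (K := F) (V := Module.Dual F h.toSubmodule),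
    Module.natCard_eq_pow_finrank (K := F) (V := h.toSubmodule), Subspace.dual_finrank_eq]

theorem fourier_conj (h : NonUnitalSubalgebra F N) (c : Module.Dual F h.toSubmodule → ℂ)
    (g x : algSubgroup h) :
    fourier θ h c (g * x * g⁻¹) = fourier θ h (fun kappa => c (coad h g⁻¹ kappa)) x := by
  have := Fintype.ofFinite (Module.Dual F h.toSubmodule)
  rw [fourier_apply, fourier_apply,
    ← Equiv.sum_comp (coadEquiv h g) fun kappa => c (coad h g⁻¹ kappa) * θ (kappa (subOne h x))]
  refine Finset.sum_congr rfl fun kappa _ => ?_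
  change _ = c (coad h g⁻¹ (coad h g kappa)) * θ (coad h g kappa (subOne h x))
  rw [coad_coad, mul_inv_cancel, coad_one, coad_subOne]

/-- The transform intertwines conjugation on `1 + h` with the coadjoint action. -/
theorem isClassFun_fourier_iff (hθ : θ ≠ 1) (h : NonUnitalSubalgebra F N)
    (c : Module.Dual F h.toSubmodule → ℂ) :
    IsClassFun (fourier θ h c) ↔ ∀ g kappa, c (coad h g kappa) = c kappa := by
  constructor
  · intro hc g kappa
    have h1 : fourier θ h (fun kappa => c (coad h g kappa)) = fourier θ h c := by
      ext x
      have := fourier_conj (θ := θ) h c g⁻¹ x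
      rw [hc, inv_inv] at this
      exact this.symm
    exact congrFun (fourier_injective hθ h h1) kappa
  · intro hc x g
    rw [fourier_conj]
    simp only [hc]

variable (lam : Module.Dual F N)

/-- Left multiplication by `s ∈ S` preserves `𝔩_λ` and the values of `λ` on it. Hence translation by
`L` in the group is additive translation by `𝔩_λ`, which the transform turns into multiplication by
`θ(κ(Z))`; equivariance then forces `κ = λ` on `𝔩_λ` wherever `c κ ≠ 0`. -/
theorem fourier_equivariant_iff (hθ : θ ≠ 1)
    (c : Module.Dual F (sAlg lam).toSubmodule → ℂ) :
    (∀ s, ∀ z ∈ (LGroup lam).subgroupOf (SGroup lam),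
      fourier θ (sAlg lam) c (s * z) = fourier θ (sAlg lam) c s * thetaFun θ lam z) ↔
    ∀ kappa ∉ restrictedOrbit lam, c kappa = 0 := by
  have := Fintype.ofFinite (Module.Dual F (sAlg lam).toSubmodule)
  have hlam : ∀ s z : SGroup lam, z ∈ (LGroup lam).subgroupOf (SGroup lam) →
      (z : AlgGroup N).val + (s : AlgGroup N).val * (z : AlgGroup N).val ∈ lAlg lam ∧
      lam ((z : AlgGroup N).val + (s : AlgGroup N).val * (z : AlgGroup N).val) =
        lam (z : AlgGroup N).val := by
    intro s z hz
    have hs : (s : AlgGroup N).val ∈ sAlg lam := s.2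
    have hz' : (z : AlgGroup N).val ∈ lAlg lam := hz
    exact ⟨add_mem hz' (mul_mem_lAlg lam hs hz'), by rw [map_add, hs _ hz', add_zero]⟩
  constructor
  · intro hc kappa hkappa
    rw [mem_restrictedOrbit_iff] at hkappa
    push Not at hkappa
    obtain ⟨X, hX, hne⟩ := hkappa
    obtain ⟨r, hr⟩ := exists_smul_apply_ne hθ hne
    set Z : (sAlg lam).toSubmodule := r • X with hZ
    have hZl : (Z : N) ∈ lAlg lam := (lAlg lam).toSubmodule.smul_mem r hX
    have h1 : fourier θ (sAlg lam) (fun nu => c nu * θ (nu Z)) =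
        fourier θ (sAlg lam) (fun nu => c nu * θ (lam Z)) := by
      ext s
      -- The element `z` is chosen so that `s z - 1 = (s - 1) + Z`; it depends on `s`, but always
      -- lies in `L` with `λ(z - 1) = λ(Z)`.
      let z : SGroup lam := s⁻¹ * (subOneEquiv (sAlg lam)).symm (subOne (sAlg lam) s + Z)
      have hsz : subOne (sAlg lam) (s * z) = subOne (sAlg lam) s + Z := by
        simp only [z, mul_inv_cancel_left]
        rfl
      have hval : (z : AlgGroup N).val = lmul (F := F) (s : AlgGroup N)⁻¹ Z := by
        have e1 := congrArg Subtype.val hsz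
        simp only [coe_subOne, Submodule.coe_add, Subgroup.coe_mul, AlgGroup.mul_val] at e1
        rw [add_assoc, add_right_inj] at e1
        rw [← e1]
        change _ = lmul (F := F) (s : AlgGroup N)⁻¹ (lmul (F := F) (s : AlgGroup N) z.1.val)
        rw [← lmul_mul, inv_mul_cancel, lmul_one]
      have hz : z ∈ (LGroup lam).subgroupOf (SGroup lam) := by
        rw [Subgroup.mem_subgroupOf, mem_algSubgroup, hval, lmul_apply]
        have hs : (s : AlgGroup N)⁻¹.val ∈ sAlg lam := (SGroup lam).inv_mem s.2
        exact add_mem hZl (mul_mem_lAlg lam hs hZl)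
      have hlz : lam Z = lam (z : AlgGroup N).val := by
        rw [← (hlam s z hz).2]
        have e1 := congrArg Subtype.val hsz
        simp only [coe_subOne, Submodule.coe_add, Subgroup.coe_mul, AlgGroup.mul_val] at e1
        rw [add_assoc, add_right_inj] at e1
        rw [e1]
      have e2 := hc s z hz
      rw [fourier_apply, fourier_apply, hsz, thetaFun, ← hlz, Finset.sum_mul] at e2
      rw [fourier_apply, fourier_apply]
      refine Eq.trans ?_ (e2.trans ?_)
      · refine Finset.sum_congr rfl fun nu _ => ?_
        rw [map_add nu, AddChar.map_add_eq_mul]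
        ring
      · exact Finset.sum_congr rfl fun nu _ => by ring
    have h2 := congrFun (fourier_injective hθ _ h1) kappa
    by_contra h0
    have h3 := mul_left_cancel₀ h0 h2
    rw [hZ, map_smul kappa, Submodule.coe_smul, map_smul lam] at h3
    exact hr h3
  · intro hc s z hz
    rw [fourier_apply, fourier_apply, Finset.sum_mul]
    refine Finset.sum_congr rfl fun kappa _ => ?_
    by_cases hkappa : kappa ∈ restrictedOrbit lam
    · have hl := hlam s z hz
      have hsz : subOne (sAlg lam) (s * z) = subOne (sAlg lam) s +
          ⟨(z : AlgGroup N).val + (s : AlgGroup N).val * (z : AlgGroup N).val,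
            lAlg_le_sAlg lam hl.1⟩ := by
        ext
        exact add_assoc _ _ _
      have hk : kappa ⟨_, lAlg_le_sAlg lam hl.1⟩ = _ :=
        (mem_restrictedOrbit_iff lam).1 hkappa ⟨_, lAlg_le_sAlg lam hl.1⟩ hl.1
      rw [hsz, map_add kappa, AddChar.map_add_eq_mul, hk, hl.2, thetaFun, mul_assoc]
    · rw [hc kappa hkappa, zero_mul, zero_mul, zero_mul]

/-- The coadjoint orbits in `{ν|_{𝔰_λ} : ν ∈ λ G}`. -/
abbrev restrictedOrbits : Set (Set (Module.Dual F (sAlg lam).toSubmodule)) :=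
  {Ω | (∃ kappa, Ω = coadjointOrbit (sAlg lam) kappa) ∧ Ω ⊆ restrictedOrbit lam}

theorem coadjointOrbit_mem_restrictedOrbits_iff {kappa : Module.Dual F (sAlg lam).toSubmodule} :
    coadjointOrbit (sAlg lam) kappa ∈ restrictedOrbits lam ↔ kappa ∈ restrictedOrbit lam := by
  constructor
  · exact fun h => h.2 (mem_coadjointOrbit_self _ _)
  · refine fun h => ⟨⟨kappa, rfl⟩, ?_⟩
    rintro _ ⟨g, rfl⟩
    exact coad_mem_restrictedOrbit lam h g

open Classical in
/-- The function on the dual of `𝔰_λ` with prescribed values on the orbits in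
`restrictedOrbits lam`, and zero elsewhere. -/
def orbitFun : (restrictedOrbits lam → ℂ) →ₗ[ℂ] (Module.Dual F (sAlg lam).toSubmodule → ℂ) where
  toFun a kappa := if h : coadjointOrbit (sAlg lam) kappa ∈ restrictedOrbits lam
    then a ⟨coadjointOrbit (sAlg lam) kappa, h⟩ else 0
  map_add' a b := by
    ext kappa
    by_cases h : coadjointOrbit (sAlg lam) kappa ∈ restrictedOrbits lam <;>
      simp only [h, Pi.add_apply, dite_true, dite_false, add_zero]
  map_smul' r a := by
    ext kappa
    by_cases h : coadjointOrbit (sAlg lam) kappa ∈ restrictedOrbits lam <;>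
      simp only [h, Pi.smul_apply, dite_true, dite_false, smul_zero, RingHom.id_apply]

theorem orbitFun_of_mem (a : restrictedOrbits lam → ℂ)
    {kappa : Module.Dual F (sAlg lam).toSubmodule}
    (h : coadjointOrbit (sAlg lam) kappa ∈ restrictedOrbits lam) :
    orbitFun lam a kappa = a ⟨coadjointOrbit (sAlg lam) kappa, h⟩ := dif_pos h

theorem orbitFun_of_notMem (a : restrictedOrbits lam → ℂ)
    {kappa : Module.Dual F (sAlg lam).toSubmodule}
    (h : coadjointOrbit (sAlg lam) kappa ∉ restrictedOrbits lam) :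
    orbitFun lam a kappa = 0 := dif_neg h

theorem orbitFun_injective : Function.Injective (orbitFun lam) := by
  intro a b hab
  ext ⟨Ω, ⟨kappa, rfl⟩, hΩ⟩
  have := congrFun hab kappa
  rwa [orbitFun_of_mem, orbitFun_of_mem] at this

open Classical in
theorem mem_range_orbitFun_iff {c : Module.Dual F (sAlg lam).toSubmodule → ℂ} :
    c ∈ LinearMap.range (orbitFun lam) ↔
      (∀ g kappa, c (coad (sAlg lam) g kappa) = c kappa) ∧
        ∀ kappa ∉ restrictedOrbit lam, c kappa = 0 := by
  constructor
  · rintro ⟨a, rfl⟩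
    refine ⟨fun g kappa => ?_, fun kappa h => ?_⟩
    · exact congrArg (fun Ω => if h : Ω ∈ restrictedOrbits lam then a ⟨Ω, h⟩ else 0)
        (coadjointOrbit_coad (sAlg lam) g kappa)
    · exact orbitFun_of_notMem lam a (mt (coadjointOrbit_mem_restrictedOrbits_iff lam).1 h)
  · rintro ⟨h1, h2⟩
    -- The value on an orbit is read off at a chosen representative; invariance of `c` makes the
    -- choice harmless.
    refine ⟨fun Ω => c (Classical.choose Ω.2.1), ?_⟩
    ext kappa
    by_cases h : coadjointOrbit (sAlg lam) kappa ∈ restrictedOrbits lam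
    · rw [orbitFun_of_mem lam _ h]
      obtain ⟨g, hg⟩ : Classical.choose h.1 ∈ coadjointOrbit (sAlg lam) kappa :=
        (Set.ext_iff.1 (Classical.choose_spec h.1) _).2 (mem_coadjointOrbit_self _ _)
      exact (congrArg c hg).symm.trans (h1 g kappa)
    · rw [orbitFun_of_notMem lam _ h, h2 kappa]
      rwa [coadjointOrbit_mem_restrictedOrbits_iff] at h

/-- The two Fourier criteria identify the equivariant class functions with arbitrary functions on
the set of orbits. -/
theorem finrank_equivariantFun (hθ : θ ≠ 1) :
    (restrictedOrbits lam).encard = Module.finrank ℂ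
      (equivariantFun ((LGroup lam).subgroupOf (SGroup lam)) fun s => thetaFun θ lam s) := by
  have : Fintype (restrictedOrbits lam) := Fintype.ofFinite _
  have hrange : equivariantFun ((LGroup lam).subgroupOf (SGroup lam)) (fun s => thetaFun θ lam s) =
      LinearMap.range ((fourier θ (sAlg lam)).comp (orbitFun lam)) := by
    ext f
    obtain ⟨c, rfl⟩ := fourier_surjective hθ (sAlg lam) f
    have h1 : fourier θ (sAlg lam) c ∈ LinearMap.range ((fourier θ (sAlg lam)).comp (orbitFun lam))
        ↔ c ∈ LinearMap.range (orbitFun lam) := by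
      constructor
      · rintro ⟨a, ha⟩
        exact ⟨a, fourier_injective hθ _ ha⟩
      · rintro ⟨a, rfl⟩
        exact ⟨a, rfl⟩
    rw [h1, mem_range_orbitFun_iff, ← isClassFun_fourier_iff hθ, ← fourier_equivariant_iff lam hθ]
    rfl
  have hinj : Function.Injective ((fourier θ (sAlg lam)).comp (orbitFun lam)) := by
    rw [LinearMap.coe_comp]
    exact (fourier_injective hθ (sAlg lam)).comp (orbitFun_injective lam)
  rw [hrange, LinearMap.finrank_range_of_inj hinj, Module.finrank_fintype_fun_eq_card,
    ← Set.coe_fintypeCard]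

end Fourier

/-! ### Degrees, inflation and the main theorem -/

section Main

theorem bijOn_sep {α β : Type*} {f : α → β} {A : Set α} {B : Set β} (h : Set.BijOn f A B)
    {p : α → Prop} {r : β → Prop} (hpr : ∀ a ∈ A, p a ↔ r (f a)) :
    Set.BijOn f {a ∈ A | p a} {b ∈ B | r b} := by
  refine ⟨fun a ha => ⟨h.mapsTo ha.1, (hpr a ha.1).1 ha.2⟩, h.injOn.mono fun a ha => ha.1, ?_⟩
  rintro b ⟨hb, hrb⟩
  obtain ⟨a, ha, rfl⟩ := h.surjOn hb
  exact ⟨a, ⟨ha, (hpr a ha).2 hrb⟩, rfl⟩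

variable {F : Type*} [Field F] [Finite F] {N : Type*} [NonUnitalRing N] [Module F N]
    [IsScalarTower F N N] [SMulCommClass F N N] [Module.Finite F N] [IsNilpotentRing N]
    {θ : AddChar F ℂ} (lam : Module.Dual F N)

theorem bijOn_induced_superchar (hθ : θ ≠ 1) :
    Set.BijOn (induced (SGroup lam))
      (IrrOver ((LGroup lam).subgroupOf (SGroup lam)) fun s => thetaFun θ lam s)
      (constituents (superchar θ lam)) := by
  have : Finite N := Module.finite_of_finite F
  have := finite_algGroup (N := N)
  exact bijOn_induced_constituents (t := thetaFun θ lam) (LGroup_le_SGroup lam)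
    (thetaFun_isInvariantChar θ lam) fun x hx => exists_thetaFun_conj_ne lam hθ hx

theorem induced_one_eq_iff (f : SGroup lam → ℂ) (b : ℂ) :
    f 1 = orbitRatio lam * b ↔ induced (SGroup lam) f 1 = b := by
  have : Finite N := Module.finite_of_finite F
  have := finite_algGroup (N := N)
  have hS : (Nat.card (SGroup lam) : ℂ) ≠ 0 := Nat.cast_ne_zero.2 Nat.card_pos.ne'
  have hG : (Nat.card (AlgGroup N) : ℂ) ≠ 0 := Nat.cast_ne_zero.2 Nat.card_pos.ne'
  rw [induced_one, orbitRatio_eq, div_mul_eq_mul_div, div_mul_eq_mul_div, eq_div_iff hG,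
    div_eq_iff hS, mul_comm (f 1), mul_comm _ b]

/-- Since `θ_λ` is trivial on `K`, a character over `θ_λ` has `K` in its kernel and descends to
`S/K`. Evaluating the condition at `z = 1` gives the degree. -/
theorem bijOn_inflation_centralIrr (e : ℕ) :
    Set.BijOn (fun (psi : SGroup lam ⧸ (KGroup lam).subgroupOf (SGroup lam) → ℂ) s =>
        psi (QuotientGroup.mk s)) (centralIrr θ lam e)
      {psi ∈ IrrOver ((LGroup lam).subgroupOf (SGroup lam)) fun s => thetaFun θ lam s |
        psi 1 = orbitRatio lam * (Nat.card F : ℂ) ^ e} := by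
  have : Finite N := Module.finite_of_finite F
  have := finite_algGroup (N := N)
  have hone : IsInvariantChar ((KGroup lam).subgroupOf (SGroup lam)) (1 : SGroup lam →* ℂ) :=
    ⟨fun _ _ _ => rfl, fun _ _ _ _ => by simp, fun _ _ => by simp⟩
  have h := bijOn_twisted_inflation 1 hone
  simp only [MonoidHom.one_apply, one_mul] at h
  have ht := (thetaFun_isInvariantChar θ lam).apply_one
  refine ⟨fun psi hpsi => ?_, h.injOn.mono fun psi hpsi => hpsi.1, fun psi hpsi => ?_⟩
  · have h1 : psi (QuotientGroup.mk 1) = orbitRatio lam * (Nat.card F : ℂ) ^ e := by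
      rw [hpsi.2 1 (one_mem _), ht, mul_one]
    exact ⟨⟨(h.mapsTo hpsi.1).1, fun z hz =>
      (hpsi.2 z hz).trans (by rw [← h1])⟩, h1⟩
  · have hK : psi ∈ IrrOver ((KGroup lam).subgroupOf (SGroup lam)) (1 : SGroup lam →* ℂ) := by
      refine ⟨hpsi.1.1, fun z hz => ?_⟩
      have hz' : (z : AlgGroup N).val ∈ kAlg lam := hz
      have hz1 : thetaFun θ lam z = 1 := by
        rw [thetaFun, hz'.2, AddChar.map_zero_eq_one]
      exact (hpsi.1.2 z hz'.1).trans (congrArg (psi 1 * ·) hz1)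
    obtain ⟨phi, hphi, rfl⟩ := h.surjOn hK
    refine ⟨phi, ⟨hphi, fun z hz => ?_⟩, rfl⟩
    rw [← hpsi.2]
    exact hpsi.1.2 z hz

/-- If `λ` vanishes on products of elements of `𝔰_λ`, then `θ_λ` is a linear character
of `S_λ`. -/
def thetaHom (θ : AddChar F ℂ) (h : ∀ X ∈ sAlg lam, ∀ Y ∈ sAlg lam, lam (X * Y) = 0) :
    SGroup lam →* ℂ where
  toFun s := thetaFun θ lam s
  map_one' := (thetaFun_isInvariantChar θ lam).apply_one
  map_mul' s s' := by
    simp only [thetaFun, Subgroup.coe_mul, AlgGroup.mul_val]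
    rw [map_add lam, map_add lam, h _ s.2 _ s'.2, add_zero, AddChar.map_add_eq_mul]

end Main

end AlgebraGroups

end

open AlgebraGroups in
theorem mainTheorem4 {F : Type*} [Field F] [Finite F] {N : Type*} [NonUnitalRing N] [Module F N]
    [IsScalarTower F N N] [SMulCommClass F N N] [Module.Finite F N] [IsNilpotentRing N]
    (θ : AddChar F ℂ) (hθ : θ ≠ 1) (lam : Module.Dual F N) :
    -- (1)
    ((constituents (superchar θ lam)).encard =
      {Ω : Set (Module.Dual F (sAlg lam).toSubmodule) |
        (∃ kappa, Ω = coadjointOrbit (sAlg lam) kappa) ∧ Ω ⊆ restrictedOrbit lam}.encard) ∧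
    -- (2), with the canonical bijection
    (∀ e : ℕ,
      {chi ∈ constituents (superchar θ lam) | chi 1 = (Nat.card F : ℂ) ^ e}.encard =
        (centralIrr θ lam e).encard ∧
      Set.BijOn
        (fun psi => induced (SGroup lam) fun s => psi (QuotientGroup.mk s))
        (centralIrr θ lam e)
        {chi ∈ constituents (superchar θ lam) | chi 1 = (Nat.card F : ℂ) ^ e}) ∧
    -- (3)
    (Submodule.span F {Z : N | ∃ X ∈ sAlg lam, ∃ Y ∈ sAlg lam, Z = X * Y} ≤ LinearMap.ker lam →
      ∀ e : ℕ,
        {chi ∈ constituents (superchar θ lam) | chi 1 = (Nat.card F : ℂ) ^ e}.encard =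
          {psi ∈ Irr (SGroup lam ⧸ (LGroup lam).subgroupOf (SGroup lam)) |
            psi 1 = orbitRatio lam * (Nat.card F : ℂ) ^ e}.encard) := by
  have : Finite N := Module.finite_of_finite F
  have := finite_algGroup (N := N)
  have hbij := bijOn_induced_superchar lam hθ
  have hdeg := fun e : ℕ => bijOn_sep hbij
    (p := fun psi => psi 1 = orbitRatio lam * (Nat.card F : ℂ) ^ e)
    (r := fun chi => chi 1 = (Nat.card F : ℂ) ^ e) fun psi _ => induced_one_eq_iff lam psi _
  refine ⟨?_, fun e => ?_, fun hs e => ?_⟩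
  · rw [← hbij.image_eq, hbij.injOn.encard_image,
      (thetaFun_isInvariantChar θ lam).encard_IrrOver, ← finrank_equivariantFun lam hθ]
  · have h := (hdeg e).comp (bijOn_inflation_centralIrr (θ := θ) lam e)
    refine ⟨?_, h⟩
    rw [← h.image_eq, h.injOn.encard_image]
  · have hs' : ∀ X ∈ sAlg lam, ∀ Y ∈ sAlg lam, lam (X * Y) = 0 := fun X hX Y hY =>
      hs (Submodule.subset_span ⟨X, hX, Y, hY, rfl⟩)
    have h := bijOn_twisted_inflation (thetaHom lam θ hs') (thetaFun_isInvariantChar θ lam)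
    -- Twisting by the linear character `θ_λ` does not change the degree, as its value at 1 is 1.
    have h' := (hdeg e).comp (bijOn_sep h
      (p := fun psi => psi 1 = orbitRatio lam * (Nat.card F : ℂ) ^ e) fun psi _ => by simp)
    rw [← h'.image_eq, h'.injOn.encard_image]
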